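/- \textbf{Setting.} For every $n\ge 0$ let $(p_{n,k})_{k\ge 1}$ be a probability distribution on $\{1,2,\dots\}$, and for all $n\ge 0$, $k\ge 1$ let $G_{n,k}$ be a probability distribution on $\mathbb{R}^k$ (identified with its distribution function). Consider the generalized branching random walk that starts with one particle at $0$ at time $0$ and in which every particle $v$ alive at time $n$, located at $S_v$, dies at time $n+1$ and is replaced by $K_v$ children at $S_v+X_{v,1},\dots,S_v+X_{v,K_v}$; here the random vectors $(K_v,X_{v,1},\dots,X_{v,K_v})$ are independent over the particles $v$, and for $v$ of generation $n$ one has $P(K_v=k)=p_{n,k}$, while, given $K_v=k$, the vector $(X_{v,1},\dots,X_{v,k})$ has law $G_{n,k}$. Let $\mathcal{M}_n$ be the maximal location of the particles alive at time $n$, let $F_n$ be its distribution function, and let $\mathrm{Med}(F_n)$ be a median of $F_n$. Let $g_{n,k}$ be the common one-dimensional marginal of $G_{n,k}$; if the $k$ one-dimensional marginals of $G_{n,k}$ are not all equal, let $g_{n,k}$ be their average, i.e. the common marginal of the symmetrization of $G_{n,k}$ over permutations of the coordinates (this replacement does not change $F_n$). \textbf{Theorem.} Assume (conditions on $G_{n,k}$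 and $g_{n,k}$ being required only for those $n,k$ with $p_{n,k}\neq 0$): \begin{itemize} \item[(B1')] there are positive real numbers $m_0,m_1$ with $\inf_n\sum_{k\ge1}k\,p_{n,k}>m_0>1$ and $\sup_n\sum_{k\ge1}k^2p_{n,k}<m_1$; \item[(MT0')] $g_{n,k}=g_n$ does not depend on $k$; write $\bar g_n(x)=1-g_n(x)=g_n((x,\infty))$; \item[(MT1')] for some $\epsilon_0<\min\{\tfrac14\log m_0,\,1\}$ there is $x_0\in\mathbb{R}$ such that $\bar g_n(x_0)\ge 1-\epsilon_0$ for all $n$; \item[(MT2')] there are $a>0$ and $M_0>0$ such that $\bar g_n(x+M)\le e^{-aM}\bar g_n(x)$ for all $n$, all $M>M_0$ and all $x\ge 0$; \item[(GT')] for every $\eta_1>0$ there is $B>0$ such that $G_{n,k}((-\infty,B]^k)\ge 1-\eta_1$ and $\bar g_n(-B)\ge 1-\eta_1$ for all $n$ and $k$. \end{itemize} Then the laws of the recentered maxima $\mathcal{M}_n-\mathrm{Med}(F_n)$, $n\ge 0$, form a tight family of probability measures on $\mathbb{R}$, for every choice of the medians. -/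

import Mathlib

open MeasureTheory ProbabilityTheory
open scoped ENNReal NNReal

noncomputable section

namespace GBRW

/-- The offspring vector `(K, X₁, …, X_K)` of one particle: a number of children `K` together with
the displacements of the children relative to their parent. -/
abbrev Offspring : Type := Σ k : ℕ, (Fin k → ℝ)

/-- The law of the offspring vector when `K` has law `p` and, given `K = k`, the displacement
vector has law `G k` on `ℝᵏ`. -/
def offspringLaw (p : PMF ℕ) (G : (k : ℕ) → Measure (Fin k → ℝ)) : Measure Offspring :=
  Measure.sum fun k => p k • (G k).map (Sigma.mk k)

/-- Particles are labelled by their ancestral lines, most recent step first: the root is `[]`, and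
the `i`-th child (counted from `0`) of `v` is `i :: v`.  The vectors `ξ v` drive a generalized
branching random walk with branching rules `p n` and displacement laws `G n k` when they are
independent and when, for a label `v` of generation `n`, `ξ v` has the law given by `p n` and
`G n`. -/
structure IsGBRW {Ω : Type*} [MeasurableSpace Ω] (μ : Measure Ω) (p : ℕ → PMF ℕ)
    (G : (n k : ℕ) → Measure (Fin k → ℝ)) (ξ : List ℕ → Ω → Offspring) : Prop where
  indep : iIndepFun ξ μ
  law : ∀ v : List ℕ, HasLaw (ξ v) (offspringLaw (p v.length) (G v.length)) μ

/-- The labels of the particles alive at time `n`, for one realization `x` of all the offspring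
vectors. -/
def alive (x : List ℕ → Offspring) : ℕ → Finset (List ℕ)
  | 0 => {[]}
  | n + 1 => (alive x n).biUnion fun v => (Finset.range (x v).1).image fun i => i :: v

/-- The location of a particle.  The root is at `0`, and a child sits at the location of its parent
plus its displacement.  (Labels which are not alive get an irrelevant value.) -/
def location (x : List ℕ → Offspring) : List ℕ → ℝ
  | [] => 0
  | i :: v => location x v + if h : i < (x v).1 then (x v).2 ⟨i, h⟩ else 0

/-- The maximal location of the (finitely many) particles alive at time `n`. -/
def maxLocation (x : List ℕ → Offspring) (n : ℕ) : ℝ :=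
  sSup (location x '' (alive x n : Set (List ℕ)))

/-- The maximal displacement at time `n` as a random variable. -/
def maximum {Ω : Type*} (ξ : List ℕ → Ω → Offspring) (n : ℕ) (ω : Ω) : ℝ :=
  maxLocation (fun v => ξ v ω) n

/-- The law on `ℝ` of the maximal displacement at time `n`. -/
def maximumLaw {Ω : Type*} [MeasurableSpace Ω] (μ : Measure Ω) (ξ : List ℕ → Ω → Offspring)
    (n : ℕ) : Measure ℝ :=
  μ.map (maximum ξ n)

/-- The one-dimensional marginal of a displacement law on `ℝᵏ`: the average of its `k`
one-dimensional marginals, that is, the marginal of its symmetrization over the permutations of the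
coordinates.  It is the common marginal if all the marginals coincide (see `marginal_eq`). -/
def marginal {k : ℕ} (G : Measure (Fin k → ℝ)) : Measure ℝ :=
  (k : ℝ≥0∞)⁻¹ • ∑ i : Fin k, G.map fun y => y i

theorem marginal_eq {k : ℕ} (hk : k ≠ 0) (G : Measure (Fin k → ℝ)) (ν : Measure ℝ)
    (h : ∀ i : Fin k, (G.map fun y => y i) = ν) : marginal G = ν := by
  have h0 : (k : ℝ≥0∞) ≠ 0 := by exact_mod_cast hk
  simp only [marginal, h, Finset.sum_const, Finset.card_univ, Fintype.card_fin]
  rw [← Nat.cast_smul_eq_nsmul ℝ≥0∞, smul_smul,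
    ENNReal.inv_mul_cancel h0 (ENNReal.natCast_ne_top k), one_smul]

/-- The right tail `x ↦ ν (x, ∞)` of a law `ν` on `ℝ`. -/
def tail (ν : Measure ℝ) (x : ℝ) : ℝ := ν.real (Set.Ioi x)

/-- `m` is a median of `ν`. -/
def IsMedian (ν : Measure ℝ) (m : ℝ) : Prop :=
  1 / 2 ≤ ν.real (Set.Iic m) ∧ 1 / 2 ≤ ν.real (Set.Ici m)

end GBRW

end

/-! Splitting the tree at the root turns the distribution functions of the maxima into a recursion:
F at time n+1 is E ∏ F(x - X_i), where F on the right is the distribution function at time n in the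
environment shifted by one generation. All estimates are therefore proved for every sequence of
offspring laws satisfying the same quantitative bounds (`Admissible`), by induction on time.

Right tails. Write u = 1 - F. The core is the inequality (1+ε)u(x) - u(x-M) ≤ C u(x)², with
constants depending only on those bounds; it passes through one step of the recursion
(`IsStep.lyapunov`). Indeed u after a step is at most m∫u(x-y)dg, and at least the same kind of
integral minus a quadratic correction. The leading terms compare by induction. Large displacements
are rare by the exponential decay of g, and their cost is absorbed by a gain left over in a
pointwise inequality. What remains is quadratic, and since m > 1 the constant C does not
deteriorate. Where u is small, the inequality says that u shrinks by a factor 1+ε/2 over each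
distance M, so the right tail decays geometrically beyond the δ-quantile (`exists_right_tail`).

Left tails. The union bound and the right tail estimate show that δ-quantiles of consecutive
generations differ by a bounded amount in the needed direction (`exists_quantile_shift`). Branching
lowers the value f of a distribution function by a multiple of f(1-f) in one generation, up to a
small displacement error. Following boundedly many generations brings 1-δ down to any η
(`exists_left_tail`). The left estimate also puts the δ-quantile within bounded distance of the
median, so both tails are controlled around the median (`exists_tightness_bound`). -/

noncomputable section

namespace GBRW

/-! ### Decomposition of the tree at the root -/

/-- The displacement of the `i`-th child, with value `0` if there is no such child. -/
def disp (s : Offspring) (i : ℕ) : ℝ := if h : i < s.1 then s.2 ⟨i, h⟩ else 0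

/-- The offspring vectors in the subtree of the `i`-th child of the root. -/
def subtree (x : List ℕ → Offspring) (i : ℕ) (w : List ℕ) : Offspring := x (w ++ [i])

theorem location_append_singleton (x : List ℕ → Offspring) (i : ℕ) (w : List ℕ) :
    location x (w ++ [i]) = disp (x []) i + location (subtree x i) w := by
  induction w with
  | nil => simp [location, disp]
  | cons j w ih =>
    rw [List.cons_append, location, location, ih, add_assoc]
    rfl

theorem mem_alive_succ (x : List ℕ → Offspring) (n : ℕ) (v : List ℕ) :
    v ∈ alive x (n + 1) ↔ ∃ w ∈ alive x n, ∃ i < (x w).1, i :: w = v := by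
  simp [alive]

theorem mem_alive_succ_iff_subtree (x : List ℕ → Offspring) (n : ℕ) (v : List ℕ) :
    v ∈ alive x (n + 1) ↔ ∃ i < (x []).1, ∃ w ∈ alive (subtree x i) n, w ++ [i] = v := by
  induction n generalizing v with
  | zero => simp [alive]
  | succ n ih =>
    rw [mem_alive_succ]
    constructor
    · rintro ⟨w, hw, j, hj, rfl⟩
      obtain ⟨i, hi, w', hw', rfl⟩ := (ih w).1 hw
      exact ⟨i, hi, j :: w', (mem_alive_succ _ _ _).2 ⟨w', hw', j, hj, rfl⟩, rfl⟩
    · rintro ⟨i, hi, w, hw, rfl⟩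
      obtain ⟨w', hw', j, hj, rfl⟩ := (mem_alive_succ _ _ _).1 hw
      exact ⟨w' ++ [i], (ih _).2 ⟨i, hi, w', hw', rfl⟩, j, hj, rfl⟩

/-- All the particles alive at time `n` are in `(-∞, z]`. -/
def allBelow (n : ℕ) (z : ℝ) : Set (List ℕ → Offspring) :=
  {x | ∀ v ∈ alive x n, location x v ≤ z}

theorem mem_allBelow_succ (x : List ℕ → Offspring) (n : ℕ) (z : ℝ) :
    x ∈ allBelow (n + 1) z ↔
      ∀ i ∈ Finset.range (x []).1, subtree x i ∈ allBelow n (z - disp (x []) i) := by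
  simp only [allBelow, Set.mem_ofPred_eq, Finset.mem_range]
  constructor
  · intro h i hi w hw
    have := h (w ++ [i]) ((mem_alive_succ_iff_subtree x n _).2 ⟨i, hi, w, hw, rfl⟩)
    rw [location_append_singleton] at this
    linarith
  · intro h v hv
    obtain ⟨i, hi, w, hw, rfl⟩ := (mem_alive_succ_iff_subtree x n _).1 hv
    rw [location_append_singleton]
    linarith [h i hi w hw]

/-! ### Measurability of locations and maxima -/

theorem measurable_sigma_iff {α : Type*} {β : α → Type*} [∀ a, MeasurableSpace (β a)]
    {γ : Type*} [MeasurableSpace γ] {f : Sigma β → γ} :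
    Measurable f ↔ ∀ a, Measurable fun b => f ⟨a, b⟩ := by
  refine ⟨fun h a t ht => ?_, fun h t ht => ?_⟩
  · exact (MeasurableSpace.measurableSet_iInf.1 (h ht)) a
  · exact MeasurableSpace.measurableSet_iInf.2 fun a => h a ht

theorem measurable_fst : Measurable fun s : Offspring => s.1 :=
  measurable_sigma_iff.2 fun _ => measurable_const

theorem measurable_disp (i : ℕ) : Measurable fun s : Offspring => disp s i := by
  refine measurable_sigma_iff.2 fun k => ?_
  by_cases h : i < k
  · simpa [disp, h] using measurable_pi_apply (⟨i, h⟩ : Fin k)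
  · simp [disp, h]

theorem measurable_location (v : List ℕ) :
    Measurable fun x : List ℕ → Offspring => location x v := by
  induction v with
  | nil => exact measurable_const
  | cons i v ih => exact ih.add ((measurable_disp i).comp (measurable_pi_apply v))

theorem measurableSet_mem_alive (n : ℕ) (v : List ℕ) :
    MeasurableSet {x : List ℕ → Offspring | v ∈ alive x n} := by
  induction n generalizing v with
  | zero => simp [alive]
  | succ n ih =>
    simp only [mem_alive_succ]
    have : {x : List ℕ → Offspring | ∃ w ∈ alive x n, ∃ i < (x w).1, i :: w = v} =
        ⋃ w : List ℕ, ⋃ i : ℕ, {x | w ∈ alive x n} ∩ ({x | i < (x w).1} ∩ {_x | i :: w = v}) := by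
      ext x; simp
    rw [this]
    refine .iUnion fun w => .iUnion fun i => (ih w).inter (.inter ?_ (.const _))
    exact measurableSet_lt measurable_const (measurable_fst.comp (measurable_pi_apply w))

theorem measurable_subtree : Measurable subtree :=
  measurable_pi_iff.2 fun i => measurable_pi_iff.2 fun w => measurable_pi_apply (w ++ [i])

theorem measurableSet_subtree_allBelow (n : ℕ) (z : ℝ) :
    MeasurableSet {q : Offspring × (ℕ → List ℕ → Offspring) |
      ∀ i ∈ Finset.range q.1.1, q.2 i ∈ allBelow n (z - disp q.1 i)} := by
  have : {q : Offspring × (ℕ → List ℕ → Offspring) |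
      ∀ i ∈ Finset.range q.1.1, q.2 i ∈ allBelow n (z - disp q.1 i)} =
      ⋂ i : ℕ, ⋂ v : List ℕ, {q | i < q.1.1}ᶜ ∪ ({q | v ∈ alive (q.2 i) n}ᶜ ∪
        {q | location (q.2 i) v ≤ z - disp q.1 i}) := by
    ext q
    simp only [allBelow, Set.mem_ofPred_eq, Finset.mem_range, Set.mem_iInter, Set.mem_union,
      Set.mem_compl_iff, ← imp_iff_not_or]
    exact ⟨fun h i v hi hv => h i hi v hv, fun h i hi v hv => h i v hi hv⟩
  rw [this]
  have h2 (i : ℕ) : Measurable fun q : Offspring × (ℕ → List ℕ → Offspring) => q.2 i :=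
    (measurable_pi_apply i).comp measurable_snd
  refine .iInter fun i => .iInter fun v => .union (.compl ?_) (.union (.compl ?_) ?_)
  · exact measurableSet_lt measurable_const (measurable_fst.comp _root_.measurable_fst)
  · exact h2 i (measurableSet_mem_alive n v)
  · exact measurableSet_le ((measurable_location v).comp (h2 i))
      (measurable_const.sub ((measurable_disp i).comp _root_.measurable_fst))

theorem measurableSet_allBelow (n : ℕ) (z : ℝ) : MeasurableSet (allBelow n z) := by
  have : allBelow n z = ⋂ v : List ℕ, {x | v ∈ alive x n}ᶜ ∪ {x | location x v ≤ z} := by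
    ext x
    simp only [allBelow, Set.mem_ofPred_eq, Set.mem_iInter, Set.mem_union,
      Set.mem_compl_iff, ← imp_iff_not_or]
  rw [this]
  exact .iInter fun v => .union (measurableSet_mem_alive n v).compl
    (measurableSet_le (measurable_location v) measurable_const)

/-- Nonemptiness is needed because `sSup ∅ = 0`. The sets `allBelow` satisfy the root recursion with
no such proviso, which is why the recursion is stated for them. -/
theorem maxLocation_le_iff {x : List ℕ → Offspring} {n : ℕ} (h : (alive x n).Nonempty) (z : ℝ) :
    maxLocation x n ≤ z ↔ x ∈ allBelow n z := by
  rw [maxLocation, csSup_le_iff ((alive x n).finite_toSet.image _).bddAbove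
    ((Finset.coe_nonempty.2 h).image _)]
  simp [allBelow]

theorem measurable_maxLocation (n : ℕ) :
    Measurable fun x : List ℕ → Offspring => maxLocation x n := by
  refine measurable_of_Iic fun z => ?_
  have hne : MeasurableSet {x : List ℕ → Offspring | (alive x n).Nonempty} := by
    have : {x : List ℕ → Offspring | (alive x n).Nonempty} = ⋃ v, {x | v ∈ alive x n} := by
      ext x; simp [Finset.Nonempty]
    rw [this]
    exact .iUnion fun v => measurableSet_mem_alive n v
  have : (fun x : List ℕ → Offspring => maxLocation x n) ⁻¹' Set.Iic z =
      ({x | (alive x n).Nonempty} ∩ allBelow n z) ∪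
        ({x | (alive x n).Nonempty}ᶜ ∩ {_x | 0 ≤ z}) := by
    ext x
    by_cases h : (alive x n).Nonempty
    · simp [h, maxLocation_le_iff h]
    · have h' : alive x n = ∅ := Finset.not_nonempty_iff_eq_empty.1 h
      simp [h', maxLocation]
  rw [this]
  exact (hne.inter (measurableSet_allBelow n z)).union (hne.compl.inter (.const _))

/-! ### The recursion for the distribution functions -/

/-- The recursion for distribution functions of maxima: `F` is the distribution function of the
maximum of the subtree of each child. -/
def recursionStep (ν : Measure Offspring) (F : ℝ → ℝ) (x : ℝ) : ℝ :=
  ∫ s, ∏ i ∈ Finset.range s.1, F (x - disp s i) ∂ν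

/-- The distribution function of the maximum at time `n`, for the laws `L j` of the offspring
vectors of the particles of generation `j`. -/
def maxCDF : (ℕ → Measure Offspring) → ℕ → ℝ → ℝ
  | _, 0 => Set.indicator (Set.Ici 0) 1
  | L, n + 1 => recursionStep (L 0) (maxCDF (fun j => L (j + 1)) n)

/-- The joint law of independent offspring vectors, with law `L j` in generation `j`. -/
def fieldLaw (L : ℕ → Measure Offspring) : Measure (List ℕ → Offspring) :=
  Measure.infinitePi fun v : List ℕ => L v.length

section

variable (L : ℕ → Measure Offspring) [∀ j, IsProbabilityMeasure (L j)]

instance : IsProbabilityMeasure (fieldLaw L) := by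
  unfold fieldLaw; infer_instance

/-- The labels `w ++ [i]` are distinct for distinct pairs (i, w), so the subtrees read disjoint
coordinates of a product measure; the extra letter shifts the generation by one. -/
theorem fieldLaw_map_subtree :
    (fieldLaw L).map subtree = Measure.infinitePi fun _ : ℕ => fieldLaw fun j => L (j + 1) := by
  have hinj : Function.Injective fun q : ℕ × List ℕ => q.2 ++ [q.1] := by
    rintro ⟨i, v⟩ ⟨j, w⟩ h
    have := List.append_inj' h rfl
    simp_all
  have h := Measure.map_infinitePi_infinitePi_of_inj
    (P := fun v : List ℕ => L v.length) hinj
  have h2 := Measure.infinitePi_map_curry (fun (_ : ℕ) (w : List ℕ) => L (w.length + 1))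
  have h3 : (fun q : ℕ × List ℕ => L (q.2 ++ [q.1]).length) = fun q => L (q.2.length + 1) := by
    ext q : 1; simp
  rw [h3] at h
  unfold fieldLaw
  rw [← h2, ← h, Measure.map_map (by fun_prop) (by fun_prop)]
  rfl

theorem indepFun_root_subtree :
    IndepFun (fun x : List ℕ → Offspring => x []) subtree (fieldLaw L) := by
  have hi : iIndepFun (fun (v : List ℕ) (x : List ℕ → Offspring) => x v) (fieldLaw L) :=
    iIndepFun_infinitePi (P := fun v : List ℕ => L v.length) (X := fun _ s => s)
      fun _ => measurable_id
  have h := indep_iSup_of_disjoint (fun v => (measurable_pi_apply v).comap_le) hi.iIndep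
    (S := {[]}) (T := {[]}ᶜ) disjoint_compl_right
  rw [IndepFun_iff_Indep]
  refine indep_of_indep_of_le_left (indep_of_indep_of_le_right h ?_) ?_
  · simp only [MeasurableSpace.pi, MeasurableSpace.comap_iSup, MeasurableSpace.comap_comp]
    exact iSup_le fun i => iSup_le fun w => le_iSup₂_of_le
      (f := fun (v : List ℕ) (_ : v ∈ ({[]}ᶜ : Set (List ℕ))) =>
        MeasurableSpace.comap (fun x : List ℕ → Offspring => x v) inferInstance)
      (w ++ [i]) (by simp) le_rfl
  · exact le_iSup₂_of_le (f := fun (v : List ℕ) (_ : v ∈ ({[]} : Set (List ℕ))) =>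
      MeasurableSpace.comap (fun x : List ℕ → Offspring => x v) inferInstance) [] rfl le_rfl

theorem fieldLaw_map_eval (v : List ℕ) : (fieldLaw L).map (fun x => x v) = L v.length :=
  Measure.infinitePi_map_eval _ v

/-- Given the root's offspring vector, the subtrees are independent, which yields the product. The
induction needs all `L` and `z`, since subtrees live in the shifted environment at displaced levels.
-/
theorem fieldLaw_allBelow (n : ℕ) (z : ℝ) :
    (fieldLaw L).real (allBelow n z) = maxCDF L n z := by
  induction n generalizing L z with
  | zero =>
    by_cases h : 0 ≤ z
    · have : allBelow 0 z = Set.univ := by ext x; simp [allBelow, alive, location, h]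
      simp [this, maxCDF, h]
    · have : allBelow 0 z = ∅ := by ext x; simp [allBelow, alive, location, not_le.1 h]
      simp [this, maxCDF, h]
  | succ n ih =>
    have hmap := (indepFun_iff_map_prod_eq_prod_map_map (measurable_pi_apply _).aemeasurable
      measurable_subtree.aemeasurable).1 (indepFun_root_subtree L)
    rw [fieldLaw_map_eval, fieldLaw_map_subtree] at hmap
    have hpre : allBelow (n + 1) z = (fun x : List ℕ → Offspring => (x [], subtree x)) ⁻¹'
        {q | ∀ i ∈ Finset.range q.1.1, q.2 i ∈ allBelow n (z - disp q.1 i)} := by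
      ext x; exact mem_allBelow_succ x n z
    have hm := measurableSet_subtree_allBelow n z
    have hs : (fieldLaw L) (allBelow (n + 1) z) = ∫⁻ s, ENNReal.ofReal
        (∏ i ∈ Finset.range s.1, maxCDF (fun j => L (j + 1)) n (z - disp s i)) ∂(L 0) := by
      rw [hpre, ← Measure.map_apply ((measurable_pi_apply _).prodMk measurable_subtree) hm, hmap,
        Measure.prod_apply hm]
      refine lintegral_congr fun s => ?_
      have : Prod.mk s ⁻¹' {q : Offspring × (ℕ → List ℕ → Offspring) |
          ∀ i ∈ Finset.range q.1.1, q.2 i ∈ allBelow n (z - disp q.1 i)} =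
          Set.pi (Finset.range s.1) fun i => allBelow n (z - disp s i) := by
        ext r; simp
      rw [this, Measure.infinitePi_pi _ fun i _ => measurableSet_allBelow _ _]
      simp_rw [← ih, Measure.real]
      rw [ENNReal.ofReal_prod_of_nonneg fun _ _ => ENNReal.toReal_nonneg]
      simp [ENNReal.ofReal_toReal]
    rw [Measure.real, hs, maxCDF, recursionStep, integral_eq_lintegral_of_nonneg_ae]
    · refine .of_forall fun s => Finset.prod_nonneg fun i _ => ?_
      rw [← ih]
      exact measureReal_nonneg
    · have : Measurable fun s : Offspring =>
          ∏ i ∈ Finset.range s.1, maxCDF (fun j => L (j + 1)) n (z - disp s i) := by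
        have hmon : Measurable (maxCDF (fun j => L (j + 1)) n) := by
          refine Monotone.measurable fun a b hab => ?_
          rw [← ih, ← ih]
          exact measureReal_mono fun x hx v hv => (hx v hv).trans hab
        refine measurable_sigma_iff.2 fun k => ?_
        exact Finset.measurable_fun_prod (Finset.range k) fun i _ => hmon.comp
          (measurable_const.sub (measurable_sigma_iff.1 (measurable_disp i) k))
      exact this.aestronglyMeasurable

theorem maxCDF_nonneg (n : ℕ) (z : ℝ) : 0 ≤ maxCDF L n z := by
  rw [← fieldLaw_allBelow]; exact measureReal_nonneg

theorem maxCDF_le_one (n : ℕ) (z : ℝ) : maxCDF L n z ≤ 1 := by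
  rw [← fieldLaw_allBelow]; exact measureReal_le_one

theorem monotone_maxCDF (n : ℕ) : Monotone (maxCDF L n) := fun a b hab => by
  rw [← fieldLaw_allBelow, ← fieldLaw_allBelow]
  exact measureReal_mono fun x hx v hv => (hx v hv).trans hab

theorem ae_alive_nonempty (hL : ∀ j, ∀ᵐ s ∂(L j), s.1 ≠ 0) (n : ℕ) :
    ∀ᵐ x ∂(fieldLaw L), (alive x n).Nonempty := by
  have h : ∀ᵐ x ∂(fieldLaw L), ∀ v, (x v).1 ≠ 0 := by
    refine ae_all_iff.2 fun v => ?_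
    have := hL v.length
    rw [← fieldLaw_map_eval L v] at this
    exact ae_of_ae_map (measurable_pi_apply v).aemeasurable this
  filter_upwards [h] with x hx
  induction n with
  | zero => simp [alive]
  | succ n ih =>
    obtain ⟨v, hv⟩ := ih
    exact ⟨0 :: v, (mem_alive_succ _ _ _).2 ⟨v, hv, 0, Nat.pos_of_ne_zero (hx v), rfl⟩⟩

end

section

variable {Ω : Type*} [MeasurableSpace Ω] {μ : Measure Ω} {p : ℕ → PMF ℕ}
  {G : (n k : ℕ) → Measure (Fin k → ℝ)} {ξ : List ℕ → Ω → Offspring}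

theorem IsGBRW.aemeasurable_field (h : IsGBRW μ p G ξ) : AEMeasurable (fun ω v => ξ v ω) μ :=
  aemeasurable_pi_iff.2 fun v => (h.law v).aemeasurable

theorem IsGBRW.hasLaw_field (h : IsGBRW μ p G ξ) :
    HasLaw (fun ω v => ξ v ω) (fieldLaw fun j => offspringLaw (p j) (G j)) μ :=
  h.indep.hasLaw_infinitePi h.law h.aemeasurable_field

theorem IsGBRW.aemeasurable_maximum (h : IsGBRW μ p G ξ) (n : ℕ) :
    AEMeasurable (maximum ξ n) μ :=
  (measurable_maxLocation n).comp_aemeasurable h.aemeasurable_field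

theorem IsGBRW.maximumLaw_Iic (h : IsGBRW μ p G ξ)
    [∀ j, IsProbabilityMeasure (offspringLaw (p j) (G j))]
    (h0 : ∀ j, ∀ᵐ s ∂(offspringLaw (p j) (G j)), s.1 ≠ 0) (n : ℕ) (z : ℝ) :
    (maximumLaw μ ξ n).real (Set.Iic z) = maxCDF (fun j => offspringLaw (p j) (G j)) n z := by
  have h1 : maximumLaw μ ξ n =
      (fieldLaw fun j => offspringLaw (p j) (G j)).map fun x => maxLocation x n := by
    rw [← h.hasLaw_field.map_eq,
      AEMeasurable.map_map_of_aemeasurable (measurable_maxLocation n).aemeasurable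
        h.aemeasurable_field]
    rfl
  rw [h1, map_measureReal_apply (measurable_maxLocation n) measurableSet_Iic,
    ← fieldLaw_allBelow]
  refine measureReal_congr ?_
  filter_upwards [ae_alive_nonempty (fun j => offspringLaw (p j) (G j)) h0 n] with x hx
  exact propext (maxLocation_le_iff hx z)

end

/-! ### One-step moment estimates -/

theorem prod_one_sub_bounds {ι : Type*} (s : Finset ι) {v : ι → ℝ} (h0 : ∀ i, 0 ≤ v i)
    (h1 : ∀ i, v i ≤ 1) :
    1 - ∑ i ∈ s, v i ≤ ∏ i ∈ s, (1 - v i) ∧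
      ∏ i ∈ s, (1 - v i) ≤ 1 - ∑ i ∈ s, v i + (∑ i ∈ s, v i) ^ 2 := by
  classical
  induction s using Finset.induction_on with
  | empty => simp
  | insert a s ha ih =>
    rw [Finset.sum_insert ha, Finset.prod_insert ha]
    have hp : ∏ i ∈ s, (1 - v i) ≤ 1 :=
      Finset.prod_le_one (fun i _ => sub_nonneg.2 (h1 i)) fun i _ => by linarith [h0 i]
    have hs : 0 ≤ ∑ i ∈ s, v i := Finset.sum_nonneg fun i _ => h0 i
    have := h0 a
    have := h1 a
    constructor
    · nlinarith [mul_nonneg (h0 a) (sub_nonneg.2 hp)]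
    · nlinarith [mul_nonneg (h0 a) (sub_nonneg.2 ih.1), mul_nonneg (h0 a) hs,
        mul_nonneg (h0 a) (h0 a)]

/-- The many-to-one formula and the moment bounds for an offspring law `ν` with mean number of
children `m` and displacement marginal `g`. -/
structure IsStep (m₀ m₁ : ℝ) (ν : Measure Offspring) (g : Measure ℝ) (m : ℝ) : Prop where
  prob : IsProbabilityMeasure ν
  prob_marginal : IsProbabilityMeasure g
  ne_zero : ∀ᵐ s ∂ν, s.1 ≠ 0
  one_lt : 1 < m₀
  lt_mean : m₀ < m
  second_pos : 0 < m₁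
  lintegral_sum : ∀ h : ℝ → ℝ≥0∞, Measurable h →
    ∫⁻ s, ∑ i ∈ Finset.range s.1, h (disp s i) ∂ν = ENNReal.ofReal m * ∫⁻ y, h y ∂g
  lintegral_mul_sum : ∀ h : ℝ → ℝ≥0∞, Measurable h →
    ∫⁻ s, s.1 * ∑ i ∈ Finset.range s.1, h (disp s i) ∂ν ≤ ENNReal.ofReal m₁ * ∫⁻ y, h y ∂g

theorem measurable_sum_disp {γ : Type*} [MeasurableSpace γ] [AddCommMonoid γ]
    [MeasurableAdd₂ γ] {h : ℝ → γ} (hh : Measurable h) :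
    Measurable fun s : Offspring => ∑ i ∈ Finset.range s.1, h (disp s i) :=
  measurable_sigma_iff.2 fun k => Finset.measurable_fun_sum (Finset.range k) fun i _ =>
    hh.comp (measurable_sigma_iff.1 (measurable_disp i) k)

theorem measurable_prod_disp {F : ℝ → ℝ} (hF : Measurable F) (x : ℝ) :
    Measurable fun s : Offspring => ∏ i ∈ Finset.range s.1, F (x - disp s i) :=
  measurable_sigma_iff.2 fun k => Finset.measurable_fun_prod (Finset.range k) fun i _ =>
    hF.comp (measurable_const.sub (measurable_sigma_iff.1 (measurable_disp i) k))

theorem measurable_natCast_fst {γ : Type*} [MeasurableSpace γ] [NatCast γ] :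
    Measurable fun s : Offspring => (s.1 : γ) :=
  (measurable_from_nat (f := fun n : ℕ => (n : γ))).comp measurable_fst

theorem integrable_of_mem_Icc {α : Type*} [MeasurableSpace α] {μ : Measure α} [IsFiniteMeasure μ]
    {f : α → ℝ} (hf : Measurable f) {c : ℝ} (h0 : ∀ y, 0 ≤ f y) (h1 : ∀ y, f y ≤ c) :
    Integrable f μ :=
  .of_bound hf.aestronglyMeasurable c (.of_forall fun y => by
    rw [Real.norm_of_nonneg (h0 y)]; exact h1 y)

namespace IsStep

variable {m₀ m₁ m : ℝ} {ν : Measure Offspring} {g : Measure ℝ}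

section

variable (H : IsStep m₀ m₁ ν g m) {h : ℝ → ℝ} (hh : Measurable h)
  (h0 : ∀ y, 0 ≤ h y) {c : ℝ} (h1 : ∀ y, h y ≤ c)
include H hh h0 h1

theorem lintegral_ofReal_sum :
    ∫⁻ s, ENNReal.ofReal (∑ i ∈ Finset.range s.1, h (disp s i)) ∂ν =
      ENNReal.ofReal (m * ∫ y, h y ∂g) := by
  have := H.prob_marginal
  rw [ENNReal.ofReal_mul (by linarith [H.lt_mean, H.one_lt]), ofReal_integral_eq_lintegral_ofReal
    (integrable_of_mem_Icc hh h0 h1) (.of_forall h0), ← H.lintegral_sum _ hh.ennreal_ofReal]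
  refine lintegral_congr fun s => ?_
  rw [ENNReal.ofReal_sum_of_nonneg fun i _ => h0 _]

theorem lintegral_ofReal_mul_sum :
    ∫⁻ s, ENNReal.ofReal (s.1 * ∑ i ∈ Finset.range s.1, h (disp s i)) ∂ν ≤
      ENNReal.ofReal (m₁ * ∫ y, h y ∂g) := by
  have := H.prob_marginal
  rw [ENNReal.ofReal_mul H.second_pos.le, ofReal_integral_eq_lintegral_ofReal
    (integrable_of_mem_Icc hh h0 h1) (.of_forall h0)]
  refine le_trans (lintegral_mono fun s => ?_) (H.lintegral_mul_sum _ hh.ennreal_ofReal)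
  rw [ENNReal.ofReal_mul (Nat.cast_nonneg _), ENNReal.ofReal_natCast,
    ENNReal.ofReal_sum_of_nonneg fun i _ => h0 _]

theorem integrable_sum : Integrable (fun s => ∑ i ∈ Finset.range s.1, h (disp s i)) ν := by
  refine ⟨(measurable_sum_disp hh).aestronglyMeasurable, ?_⟩
  rw [hasFiniteIntegral_iff_ofReal (.of_forall fun s => Finset.sum_nonneg fun i _ => h0 _),
    H.lintegral_ofReal_sum hh h0 h1]
  exact ENNReal.ofReal_lt_top

theorem integral_sum :
    ∫ s, ∑ i ∈ Finset.range s.1, h (disp s i) ∂ν = m * ∫ y, h y ∂g := by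
  rw [integral_eq_lintegral_of_nonneg_ae (.of_forall fun s => Finset.sum_nonneg fun i _ => h0 _)
    (measurable_sum_disp hh).aestronglyMeasurable, H.lintegral_ofReal_sum hh h0 h1,
    ENNReal.toReal_ofReal]
  exact mul_nonneg (by linarith [H.lt_mean, H.one_lt]) (integral_nonneg h0)

theorem integrable_mul_sum :
    Integrable (fun s => s.1 * ∑ i ∈ Finset.range s.1, h (disp s i)) ν := by
  refine ⟨(measurable_natCast_fst.mul (measurable_sum_disp hh)).aestronglyMeasurable, ?_⟩
  rw [hasFiniteIntegral_iff_ofReal (.of_forall fun s =>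
    mul_nonneg (Nat.cast_nonneg _) (Finset.sum_nonneg fun i _ => h0 _))]
  exact (H.lintegral_ofReal_mul_sum hh h0 h1).trans_lt ENNReal.ofReal_lt_top

theorem integral_mul_sum_le :
    ∫ s, s.1 * ∑ i ∈ Finset.range s.1, h (disp s i) ∂ν ≤ m₁ * ∫ y, h y ∂g := by
  rw [integral_eq_lintegral_of_nonneg_ae (.of_forall fun s =>
    mul_nonneg (Nat.cast_nonneg _) (Finset.sum_nonneg fun i _ => h0 _))
    (measurable_natCast_fst.mul (measurable_sum_disp hh)).aestronglyMeasurable]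
  exact ENNReal.toReal_le_of_le_ofReal (mul_nonneg H.second_pos.le (integral_nonneg h0))
    (H.lintegral_ofReal_mul_sum hh h0 h1)

end

section

variable (H : IsStep m₀ m₁ ν g m)
include H

theorem integrable_fst : Integrable (fun s : Offspring => (s.1 : ℝ)) ν := by
  simpa using H.integrable_sum (h := fun _ => 1) measurable_const (by simp) (c := 1) (by simp)

theorem integral_fst : ∫ s, (s.1 : ℝ) ∂ν = m := by
  have := H.prob_marginal
  simpa using H.integral_sum (h := fun _ => 1) measurable_const (by simp) (c := 1) (by simp)

theorem integrable_fst_sq : Integrable (fun s : Offspring => (s.1 : ℝ) ^ 2) ν := by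
  simpa [sq] using
    H.integrable_mul_sum (h := fun _ => 1) measurable_const (by simp) (c := 1) (by simp)

theorem integral_fst_sq_le : ∫ s, (s.1 : ℝ) ^ 2 ∂ν ≤ m₁ := by
  have := H.prob_marginal
  simpa [sq] using
    H.integral_mul_sum_le (h := fun _ => 1) measurable_const (by simp) (c := 1) (by simp)

theorem mean_le : m ≤ m₁ := by
  rw [← H.integral_fst]
  refine (integral_mono (H.integrable_fst) (H.integrable_fst_sq) fun s => ?_).trans
    (H.integral_fst_sq_le)
  simp only
  exact_mod_cast Nat.le_self_pow two_ne_zero s.1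

end

variable (H : IsStep m₀ m₁ ν g m) {F : ℝ → ℝ} (hF : Monotone F)
  (hF0 : ∀ x, 0 ≤ F x) (hF1 : ∀ x, F x ≤ 1)
include H hF hF0 hF1

theorem integrable_prod (x : ℝ) :
    Integrable (fun s => ∏ i ∈ Finset.range s.1, F (x - disp s i)) ν :=
  have := H.prob
  integrable_of_mem_Icc (measurable_prod_disp hF.measurable x)
    (fun _ => Finset.prod_nonneg fun _ _ => hF0 _)
    (fun _ => Finset.prod_le_one (fun _ _ => hF0 _) fun _ _ => hF1 _)

/-- Union bound over the children, followed by the many-to-one formula. -/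
theorem one_sub_recursionStep_le (x : ℝ) :
    1 - recursionStep ν F x ≤ m * ∫ y, (1 - F (x - y)) ∂g := by
  have := H.prob
  have hmeas : Measurable fun y => 1 - F (x - y) :=
    measurable_const.sub (hF.measurable.comp (measurable_const.sub measurable_id))
  have h0 : ∀ y, 0 ≤ 1 - F (x - y) := fun y => sub_nonneg.2 (hF1 _)
  have h1 : ∀ y, 1 - F (x - y) ≤ 1 := fun y => by linarith [hF0 (x - y)]
  rw [← H.integral_sum hmeas h0 h1]
  have h2 : 1 - recursionStep ν F x =
      ∫ s, (1 - ∏ i ∈ Finset.range s.1, F (x - disp s i)) ∂ν := by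
    rw [integral_sub (integrable_const _) (H.integrable_prod hF hF0 hF1 x)]
    simp [recursionStep]
  rw [h2]
  refine integral_mono ((integrable_const _).sub (H.integrable_prod hF hF0 hF1 x))
    (H.integrable_sum hmeas h0 h1) fun s => ?_
  have := (prod_one_sub_bounds (Finset.range s.1) (v := fun i => 1 - F (x - disp s i))
    (fun i => h0 _) (fun i => h1 _)).1
  simp only [sub_sub_cancel] at this
  simp only
  linarith

/-- Second-order Bonferroni, with Cauchy–Schwarz (∑v)² ≤ K∑v²; the weight K is what brings in the
second moment. Allowing any minorant `v` makes it possible to truncate, so that the quadratic term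
stays small against the linear one. -/
theorem le_one_sub_recursionStep (x : ℝ) {v : ℝ → ℝ} (hv : Measurable v)
    (hv0 : ∀ y, 0 ≤ v y) (hvF : ∀ y, v y ≤ 1 - F (x - y)) :
    m * ∫ y, v y ∂g - m₁ * ∫ y, v y ^ 2 ∂g ≤ 1 - recursionStep ν F x := by
  have := H.prob
  have hv1 : ∀ y, v y ≤ 1 := fun y => by linarith [hF0 (x - y), hvF y]
  have hv2 : ∀ y, v y ^ 2 ≤ 1 := fun y => pow_le_one₀ (hv0 y) (hv1 y)
  have h2 : 1 - recursionStep ν F x =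
      ∫ s, (1 - ∏ i ∈ Finset.range s.1, F (x - disp s i)) ∂ν := by
    rw [integral_sub (integrable_const _) (H.integrable_prod hF hF0 hF1 x)]
    simp [recursionStep]
  have h3 := H.integral_mul_sum_le (hv.pow_const 2) (fun y => sq_nonneg (v y)) hv2
  have h4 := H.integrable_mul_sum (hv.pow_const 2) (fun y => sq_nonneg (v y)) hv2
  have h5 := H.integrable_sum hv hv0 hv1
  rw [h2, ← H.integral_sum hv hv0 hv1]
  refine (sub_le_sub_left h3 _).trans ?_
  rw [← integral_sub h5 h4]
  refine integral_mono (h5.sub h4)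
    ((integrable_const _).sub (H.integrable_prod hF hF0 hF1 x)) fun s => ?_
  have h6 := (prod_one_sub_bounds (Finset.range s.1) (v := fun i => v (disp s i))
    (fun i => hv0 _) (fun i => hv1 _)).2
  have h7 : ∏ i ∈ Finset.range s.1, F (x - disp s i) ≤
      ∏ i ∈ Finset.range s.1, (1 - v (disp s i)) :=
    Finset.prod_le_prod (fun _ _ => hF0 _) fun i _ => by linarith [hvF (disp s i)]
  have h8 := sq_sum_le_card_mul_sum_sq (s := Finset.range s.1) (f := fun i => v (disp s i))
  rw [Finset.card_range] at h8
  simp only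
  linarith

/-- If no child is displaced to `-B` or below, the product is at most f^K ≤ f - f(1-f)1_{K≥2}; the
other event costs at most the expected number of such children. The second moment method gives
P(K≥2) ≥ (m₀-1)²/m₁. -/
theorem recursionStep_le {x B f : ℝ} (hf : F x ≤ f) (hf1 : f ≤ 1) :
    recursionStep ν F (x - B) ≤
      f - (m₀ - 1) ^ 2 / m₁ * (f * (1 - f)) + m₁ * g.real (Set.Iic (-B)) := by
  have := H.prob
  have := H.prob_marginal
  have hm := H.one_lt
  have hm₁ := H.second_pos
  have hf0 : 0 ≤ f := (hF0 x).trans hf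
  have hind : Measurable (Set.indicator (Set.Iic (-B)) fun _ => (1 : ℝ)) :=
    measurable_const.indicator measurableSet_Iic
  have hind0 : ∀ y, 0 ≤ Set.indicator (Set.Iic (-B)) (fun _ => (1 : ℝ)) y := fun y =>
    Set.indicator_nonneg (fun _ _ => zero_le_one) y
  have hind1 : ∀ y, Set.indicator (Set.Iic (-B)) (fun _ => (1 : ℝ)) y ≤ 1 := fun y =>
    Set.indicator_le_self' (fun _ _ => zero_le_one) y
  -- For K ≥ 1, 1_{K≥2} ≥ 2r(K-1) - r²K²; this `r` maximizes 2r(m₀-1) - r²m₁.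
  set r := (m₀ - 1) / m₁ with hr
  have hr0 : 0 ≤ r := div_nonneg (by linarith) hm₁.le
  set S : Offspring → ℝ := fun s =>
    ∑ i ∈ Finset.range s.1, Set.indicator (Set.Iic (-B)) (fun _ => (1 : ℝ)) (disp s i)
  have hS : Integrable S ν := H.integrable_sum hind hind0 hind1
  have hSi : ∫ s, S s ∂ν = m * g.real (Set.Iic (-B)) := by
    have := H.integral_sum hind hind0 hind1
    rw [integral_indicator_const _ measurableSet_Iic] at this
    simpa using this
  have hK := H.integrable_fst
  have hK2 := H.integrable_fst_sq
  have hpt : ∀ᵐ s ∂ν, ∏ i ∈ Finset.range s.1, F (x - B - disp s i) ≤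
      (f - f * (1 - f) * (2 * r * ((s.1 : ℝ) - 1) - r ^ 2 * (s.1 : ℝ) ^ 2)) + S s := by
    filter_upwards [H.ne_zero] with s hs
    have hff : 0 ≤ f * (1 - f) := mul_nonneg hf0 (sub_nonneg.2 hf1)
    have hS0 : 0 ≤ S s := Finset.sum_nonneg fun i _ => hind0 _
    have hpow : f ^ s.1 ≤
        f - f * (1 - f) * (2 * r * ((s.1 : ℝ) - 1) - r ^ 2 * (s.1 : ℝ) ^ 2) := by
      rcases Nat.lt_or_ge s.1 2 with h | h
      · have : s.1 = 1 := by omega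
        rw [this]
        norm_num
        positivity
      · have h1 : f ^ s.1 ≤ f ^ 2 := pow_le_pow_of_le_one hf0 hf1 h
        have h2 : 2 * r * ((s.1 : ℝ) - 1) - r ^ 2 * (s.1 : ℝ) ^ 2 ≤ 1 := by
          nlinarith [sq_nonneg (1 - r * s.1)]
        nlinarith [mul_le_mul_of_nonneg_left h2 hff]
    by_cases hall : ∀ i ∈ Finset.range s.1, -B < disp s i
    · have : ∏ i ∈ Finset.range s.1, F (x - B - disp s i) ≤ ∏ i ∈ Finset.range s.1, f :=
        Finset.prod_le_prod (fun _ _ => hF0 _) fun i hi =>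
          (hF (by linarith [hall i hi])).trans hf
      rw [Finset.prod_const, Finset.card_range] at this
      linarith
    · push Not at hall
      obtain ⟨i, hi, hiB⟩ := hall
      have h1 : 1 ≤ S s := by
        have := Finset.single_le_sum (f := fun i =>
          Set.indicator (Set.Iic (-B)) (fun _ => (1 : ℝ)) (disp s i)) (fun i _ => hind0 _) hi
        simpa [Set.indicator_of_mem (Set.mem_Iic.2 hiB)] using this
      have h2 : ∏ i ∈ Finset.range s.1, F (x - B - disp s i) ≤ 1 :=
        Finset.prod_le_one (fun _ _ => hF0 _) fun _ _ => hF1 _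
      have h3 : 0 ≤ f ^ s.1 := by positivity
      linarith
  have hI1 : Integrable (fun s : Offspring => 2 * r * ((s.1 : ℝ) - 1)) ν :=
    (hK.sub (integrable_const 1)).const_mul (2 * r)
  have hI2 : Integrable (fun s : Offspring => r ^ 2 * (s.1 : ℝ) ^ 2) ν := hK2.const_mul (r ^ 2)
  have hI3 : Integrable (fun s : Offspring =>
      f * (1 - f) * (2 * r * ((s.1 : ℝ) - 1) - r ^ 2 * (s.1 : ℝ) ^ 2)) ν :=
    (hI1.sub hI2).const_mul (f * (1 - f))
  have hI4 : Integrable (fun s : Offspring =>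
      f - f * (1 - f) * (2 * r * ((s.1 : ℝ) - 1) - r ^ 2 * (s.1 : ℝ) ^ 2)) ν :=
    (integrable_const f).sub hI3
  have hint := integral_mono_ae (H.integrable_prod hF hF0 hF1 (x - B)) (hI4.add hS) hpt
  have heq : ∫ s, ((f - f * (1 - f) * (2 * r * ((s.1 : ℝ) - 1) - r ^ 2 * (s.1 : ℝ) ^ 2)) + S s) ∂ν
      = f - f * (1 - f) * (2 * r * (m - 1) - r ^ 2 * ∫ s, (s.1 : ℝ) ^ 2 ∂ν) +
        m * g.real (Set.Iic (-B)) := by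
    rw [integral_add hI4 hS, integral_sub (integrable_const f) hI3, integral_const_mul,
      integral_sub hI1 hI2, integral_const_mul, integral_const_mul,
      integral_sub hK (integrable_const 1), hSi, H.integral_fst]
    simp
  have hint' : recursionStep ν F (x - B) ≤
      f - f * (1 - f) * (2 * r * (m - 1) - r ^ 2 * ∫ s, (s.1 : ℝ) ^ 2 ∂ν) +
        m * g.real (Set.Iic (-B)) := by
    rw [← heq]; exact hint
  have hc : (m₀ - 1) ^ 2 / m₁ ≤ 2 * r * (m - 1) - r ^ 2 * ∫ s, (s.1 : ℝ) ^ 2 ∂ν := by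
    have h1 : r ^ 2 * ∫ s, (s.1 : ℝ) ^ 2 ∂ν ≤ r ^ 2 * m₁ :=
      mul_le_mul_of_nonneg_left (H.integral_fst_sq_le) (sq_nonneg r)
    have h2 : 2 * r * (m₀ - 1) ≤ 2 * r * (m - 1) :=
      mul_le_mul_of_nonneg_left (by linarith [H.lt_mean, H.one_lt]) (by positivity)
    have h3 : (m₀ - 1) ^ 2 / m₁ = 2 * r * (m₀ - 1) - r ^ 2 * m₁ := by
      rw [hr]; field_simp; ring
    linarith
  have h1 := mul_le_mul_of_nonneg_left hc (mul_nonneg hf0 (sub_nonneg.2 hf1))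
  have h2 := mul_le_mul_of_nonneg_right (H.mean_le)
    (measureReal_nonneg (μ := g) (s := Set.Iic (-B)))
  linarith

end IsStep

/-! ### The Lyapunov inequality -/

/-- Stochastic domination, up to a factor, of the part of `g` on the right of `y₀` by the shift of
`g` by `M`. -/
theorem setIntegral_Ioi_le_of_tail {g : Measure ℝ} [IsProbabilityMeasure g] {f : ℝ → ℝ}
    (hf : Monotone f) (hf0 : ∀ y, 0 ≤ f y) {c : ℝ} (hfc : ∀ y, f y ≤ c) {y₀ M γ : ℝ} (hγ : 0 ≤ γ)
    (htail : ∀ z ≥ y₀, g.real (Set.Ici z) ≤ γ * g.real (Set.Ioi (z - M))) :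
    ∫ y in Set.Ioi y₀, f y ∂g ≤ γ * ∫ y, f (y + M) ∂g := by
  have hfM : Monotone fun y => f (y + M) := fun a b h => hf (by linarith)
  have hkey (T : Set ℝ) (hT : IsUpperSet T) :
      g (T ∩ Set.Ioi y₀) ≤ ENNReal.ofReal γ * g {y | y + M ∈ T} := by
    rcases (T ∩ Set.Ioi y₀).eq_empty_or_nonempty with h | h
    · simp [h]
    have hb : BddBelow (T ∩ Set.Ioi y₀) := ⟨y₀, fun y hy => hy.2.le⟩
    -- An upper set may or may not contain its infimum, hence the closed ray on the left of `htail`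
    -- and the open one on the right.
    set z := sInf (T ∩ Set.Ioi y₀)
    have hz : y₀ ≤ z := le_csInf h fun y hy => hy.2.le
    have h1 : T ∩ Set.Ioi y₀ ⊆ Set.Ici z := fun y hy => csInf_le hb hy
    have h2 : Set.Ioi (z - M) ⊆ {y | y + M ∈ T} := fun y hy => by
      obtain ⟨w, hw, hwy⟩ := (csInf_lt_iff hb h).1 (show z < y + M by
        have : z - M < y := hy
        linarith)
      exact hT hwy.le hw.1
    calc g (T ∩ Set.Ioi y₀) ≤ g (Set.Ici z) := measure_mono h1
      _ = ENNReal.ofReal (g.real (Set.Ici z)) := by simp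
      _ ≤ ENNReal.ofReal (γ * g.real (Set.Ioi (z - M))) := ENNReal.ofReal_le_ofReal (htail z hz)
      _ = ENNReal.ofReal γ * g (Set.Ioi (z - M)) := by rw [ENNReal.ofReal_mul hγ]; simp
      _ ≤ _ := by gcongr
  rw [integral_eq_lintegral_of_nonneg_ae (.of_forall hf0) hf.measurable.aestronglyMeasurable]
  refine ENNReal.toReal_le_of_le_ofReal (mul_nonneg hγ (integral_nonneg fun y => hf0 _)) ?_
  rw [ENNReal.ofReal_mul hγ, ofReal_integral_eq_lintegral_ofReal
    (integrable_of_mem_Icc hfM.measurable (fun y => hf0 _) fun y => hfc _)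
    (.of_forall fun y => hf0 _), lintegral_eq_lintegral_meas_lt _ (.of_forall hf0)
    hf.measurable.aemeasurable, lintegral_eq_lintegral_meas_lt _ (.of_forall fun y => hf0 _)
    hfM.measurable.aemeasurable, ← lintegral_const_mul' _ _ ENNReal.ofReal_ne_top]
  refine lintegral_mono fun t => ?_
  have hm : MeasurableSet {a | t < f a} := measurableSet_lt measurable_const hf.measurable
  simp only [Measure.restrict_apply hm]
  exact hkey {a | t < f a} fun a b hab ha => lt_of_lt_of_le ha (hf hab)

section pointwise

variable {ε q C τ α β : ℝ} (hε0 : 0 < ε) (hε : ε ≤ 1 / 4) (hq : 1 ≤ q) (hτ : τ = 1 / (4 * q))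
  (hC : C = 128 * q / ε) (hα : 0 ≤ α) (hαβ : α ≤ β)
include hε0 hε hq hτ hC hα hαβ

/-- In the application α = φ(y) and β = φ(y+M). If β ≥ 4α, the term -min β τ outweighs everything,
as qτ = 1/4. Otherwise nothing is truncated, `hD` applies, and the terms in β² ≤ 16α² cost 16εCα²
twice, hence 32ε. -/
theorem truncated_defect_le_of_small (hατ : α ≤ τ / 4) (hD : (1 + ε) * α - β ≤ C * α ^ 2) :
    (1 + ε) * α - min β τ + q * min β τ ^ 2 ≤
      (1 + 32 * ε) * (C * α ^ 2) - ε * min (C * β ^ 2) (min β τ) := by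
  have hq0 : 0 < q := by linarith
  have hτq : τ * q = 1 / 4 := by rw [hτ]; field_simp
  have hτ0 : 0 < τ := by rw [hτ]; positivity
  have hCε : C * ε = 128 * q := by rw [hC]; field_simp
  have hC0 : 0 < C := by rw [hC]; positivity
  rcases le_or_gt (4 * α) β with h | h
  · have hb : 4 * α ≤ min β τ := le_min h (by linarith)
    have hb1 : min β τ ≤ τ := min_le_right _ _
    have hψ : min (C * β ^ 2) (min β τ) ≤ min β τ := min_le_right _ _
    set b := min β τ
    have hqb : q * b ≤ 1 / 4 := by nlinarith
    have : q * b ^ 2 ≤ b / 4 := by nlinarith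
    have : ε * min (C * β ^ 2) b ≤ b / 4 := by nlinarith
    have : 0 ≤ (1 + 32 * ε) * (C * α ^ 2) := by positivity
    nlinarith
  · have hb : min β τ = β := min_eq_left (by linarith)
    have hψ : min (C * β ^ 2) (min β τ) ≤ C * β ^ 2 := min_le_left _ _
    rw [hb] at hψ ⊢
    have hβ : β ^ 2 ≤ 16 * α ^ 2 := by nlinarith
    have h1 : ε * min (C * β ^ 2) β ≤ ε * (C * (16 * α ^ 2)) := by
      gcongr
      exact hψ.trans (by gcongr)
    have h2 : q * β ^ 2 ≤ q * (16 * α ^ 2) := by gcongr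
    have h3 : q * (16 * α ^ 2) ≤ ε * (C * (16 * α ^ 2)) := by
      have : q ≤ ε * C := by linarith
      nlinarith [mul_le_mul_of_nonneg_right this (show (0:ℝ) ≤ 16 * α ^ 2 by positivity)]
    linarith

/-- This version serves large displacements, where α need not be small. For α ≥ τ/4 the right side
contains at least 84qτ/4 = 21/4, enough for a crude bound. The negative last term is the gain that
later absorbs the positive one. -/
theorem truncated_defect_le (hβ1 : β ≤ 1) (hD : (1 + ε) * α - β ≤ C * α ^ 2) :
    (1 + ε) * α - min β τ + q * min β τ ^ 2 ≤
      84 * q * min (C * α ^ 2) (min α τ) - ε * min (C * β ^ 2) (min β τ) := by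
  have hq0 : 0 < q := by linarith
  have hτq : τ * q = 1 / 4 := by rw [hτ]; field_simp
  have hτ0 : 0 < τ := by rw [hτ]; positivity
  have hCε : C * ε = 128 * q := by rw [hC]; field_simp
  have hC0 : 0 < C := by rw [hC]; positivity
  have hτ1 : τ ≤ 1 / 4 := by nlinarith
  have hCτ : 4 ≤ C * τ := by
    have : C * τ * ε = 32 := by linear_combination τ * hCε + 128 * hτq
    nlinarith
  have hb0 : 0 ≤ min β τ := le_min (by linarith) hτ0.le
  have hb1 : min β τ ≤ τ := min_le_right _ _
  have hqb : q * min β τ ^ 2 ≤ min β τ := by nlinarith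
  have hψβ : min (C * β ^ 2) (min β τ) ≤ min β τ := min_le_right _ _
  have hψβ0 : 0 ≤ min (C * β ^ 2) (min β τ) := le_min (by positivity) hb0
  rcases le_or_gt (τ / 4) α with h | h
  · have h1 : τ / 4 ≤ min (C * α ^ 2) (min α τ) := by
      refine le_min ?_ (le_min h (by linarith))
      have : 1 ≤ C * α := by nlinarith
      nlinarith
    nlinarith
  · have hατ : min α τ = α := min_eq_left (by linarith)
    rw [hατ]
    have hψα0 : 0 ≤ min (C * α ^ 2) α := le_min (by positivity) hα
    have h84 : 6 * min (C * α ^ 2) α ≤ 84 * q * min (C * α ^ 2) α :=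
      mul_le_mul_of_nonneg_right (by linarith) hψα0
    refine le_trans ?_ (sub_le_sub_right h84 _)
    rcases le_or_gt (4 * α) β with h4 | h4
    · have hb : 4 * α ≤ min β τ := le_min h4 (by linarith)
      set b := min β τ
      have hqb : q * b ≤ 1 / 4 := by nlinarith
      have : q * b ^ 2 ≤ b / 4 := by nlinarith
      have : ε * min (C * β ^ 2) b ≤ b / 4 := by nlinarith
      nlinarith
    · have hb : min β τ = β := min_eq_left (by linarith)
      rw [hb] at hψβ hψβ0 hqb ⊢
      have hβ : β ^ 2 ≤ 16 * α ^ 2 := by nlinarith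
      have hCβ : C * β ^ 2 ≤ 16 * (C * α ^ 2) := by nlinarith
      have hqβ : q * β ^ 2 ≤ C * α ^ 2 := by
        have : 16 * q ≤ C := by nlinarith
        nlinarith [sq_nonneg α]
      have h16 : min (C * β ^ 2) β ≤ 16 * min (C * α ^ 2) α := by
        rcases min_choice (C * α ^ 2) α with hc | hc <;> rw [hc]
        · exact (min_le_left _ _).trans hCβ
        · exact (min_le_right _ _).trans (by linarith)
      have hεα : ε * α ≤ 1 / 4 * α := mul_le_mul_of_nonneg_right hε hα
      have h2 : (1 + ε) * α - β + q * β ^ 2 ≤ 2 * min (C * α ^ 2) α := by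
        rcases min_choice (C * α ^ 2) α with hc | hc <;> rw [hc] <;> linarith
      have h3 : ε * min (C * β ^ 2) β ≤ 1 / 4 * (16 * min (C * α ^ 2) α) :=
        mul_le_mul hε h16 hψβ0 (by norm_num)
      linarith

end pointwise

theorem IsStep.recursionStep_le_one {m₀ m₁ m : ℝ} {ν : Measure Offspring} {g : Measure ℝ}
    (H : IsStep m₀ m₁ ν g m) {F : ℝ → ℝ} (hF : Monotone F) (hF0 : ∀ x, 0 ≤ F x)
    (hF1 : ∀ x, F x ≤ 1) (x : ℝ) : recursionStep ν F x ≤ 1 := by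
  have := H.prob
  have := integral_mono (H.integrable_prod hF hF0 hF1 x) (integrable_const 1) fun s =>
    Finset.prod_le_one (fun _ _ => hF0 _) fun _ _ => hF1 _
  simpa [recursionStep] using this

section truncation

variable {g : Measure ℝ} [IsProbabilityMeasure g] {φ : ℝ → ℝ} (hφ : Monotone φ)
  (hφ0 : ∀ y, 0 ≤ φ y) (hφ1 : ∀ y, φ y ≤ 1) {M t : ℝ} (ht : 0 ≤ t)
include hφ hφ0 hφ1 ht

theorem integrable_min_shift : Integrable (fun y => min (φ (y + M)) t) g :=
  integrable_of_mem_Icc ((hφ.comp (monotone_id.add_const M)).measurable.min measurable_const)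
    (fun _ => le_min (hφ0 _) ht) (c := 1) fun _ => (min_le_left _ _).trans (hφ1 _)

theorem integrable_min_shift_sq : Integrable (fun y => min (φ (y + M)) t ^ 2) g :=
  integrable_of_mem_Icc
    (((hφ.comp (monotone_id.add_const M)).measurable.min measurable_const).pow_const 2)
    (fun _ => sq_nonneg _) (c := 1) fun _ => pow_le_one₀ (le_min (hφ0 _) ht)
      ((min_le_left _ _).trans (hφ1 _))

/-- One factor 1-ε comes from keeping only displacements above `-B`, the other from the quadratic
term, which is at most ε times the linear one because the integrand is at most `t`. -/
theorem mul_min_le_of_truncated_le {m m₁ ε B w : ℝ} (hm : 1 ≤ m) (hm₁ : 0 ≤ m₁) (hε0 : 0 < ε)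
    (hε : ε ≤ 1 / 4) (hm₁t : m₁ * t ≤ ε) (hB : 1 - ε ≤ g.real (Set.Ioi (-B)))
    (hw : m * ∫ y, min (φ (y + M)) t ∂g - m₁ * ∫ y, min (φ (y + M)) t ^ 2 ∂g ≤ w) :
    m * (1 - ε) ^ 2 * min (φ (M - B)) t ≤ w := by
  have hi := integrable_min_shift (g := g) hφ hφ0 hφ1 ht (M := M)
  have h2 : ∫ y, min (φ (y + M)) t ^ 2 ∂g ≤ t * ∫ y, min (φ (y + M)) t ∂g := by
    rw [← integral_const_mul]
    refine integral_mono (integrable_min_shift_sq hφ hφ0 hφ1 ht) (hi.const_mul t) fun y => ?_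
    simp only [sq]
    exact mul_le_mul_of_nonneg_right (min_le_right _ _) (le_min (hφ0 _) ht)
  have hmin0 : 0 ≤ min (φ (M - B)) t := le_min (hφ0 _) ht
  have h3 : (1 - ε) * min (φ (M - B)) t ≤ ∫ y, min (φ (y + M)) t ∂g := by
    have h4 : ∫ y, Set.indicator (Set.Ioi (-B)) (fun _ => min (φ (M - B)) t) y ∂g ≤
        ∫ y, min (φ (y + M)) t ∂g := by
      refine integral_mono ((integrable_const _).indicator measurableSet_Ioi) hi fun y => ?_
      simp only [Set.indicator_apply]
      split_ifs with hy
      · refine min_le_min_right t (hφ ?_)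
        have : -B < y := hy
        linarith
      · exact le_min (hφ0 _) ht
    rw [integral_indicator_const _ measurableSet_Ioi, smul_eq_mul] at h4
    exact (mul_le_mul_of_nonneg_right hB hmin0).trans h4
  set I := ∫ y, min (φ (y + M)) t ∂g
  have hI0 : 0 ≤ I := le_trans (mul_nonneg (by linarith) hmin0) h3
  have h5 : m₁ * ∫ y, min (φ (y + M)) t ^ 2 ∂g ≤ ε * I :=
    (mul_le_mul_of_nonneg_left h2 hm₁).trans
      (by rw [← mul_assoc]; exact mul_le_mul_of_nonneg_right hm₁t hI0)
  have h6 : ε * I ≤ m * (ε * I) := le_mul_of_one_le_left (mul_nonneg hε0.le hI0) hm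
  have h7 : m * (1 - ε) * ((1 - ε) * min (φ (M - B)) t) ≤ m * (1 - ε) * I :=
    mul_le_mul_of_nonneg_left h3 (mul_nonneg (by linarith) (by linarith))
  linarith

end truncation

theorem integral_truncated_defect_le {g : Measure ℝ} [IsProbabilityMeasure g] {φ : ℝ → ℝ}
    (hφmono : Monotone φ) (hφ0 : ∀ y, 0 ≤ φ y) (hφ1 : ∀ y, φ y ≤ 1) {ε m₁ C τ M y₀ γ : ℝ}
    (hε0 : 0 < ε) (hε : ε ≤ 1 / 4) (hm1 : 1 ≤ m₁) (hτ : τ = 1 / (4 * m₁))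
    (hC : C = 128 * m₁ / ε) (hM : 0 ≤ M) (hγ : 0 ≤ γ) (hγε : 84 * m₁ * γ ≤ ε)
    (htail : ∀ z ≥ y₀, g.real (Set.Ici z) ≤ γ * g.real (Set.Ioi (z - M)))
    (hD : ∀ y, (1 + ε) * φ y - φ (y + M) ≤ C * φ y ^ 2) (hφ₀τ : φ y₀ ≤ τ / 4) :
    (1 + ε) * ∫ y, φ y ∂g - ∫ y, min (φ (y + M)) τ ∂g + m₁ * ∫ y, min (φ (y + M)) τ ^ 2 ∂g ≤
      (1 + 32 * ε) * (C * φ y₀ ^ 2) := by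
  have hC0 : 0 < C := by rw [hC]; positivity
  have hτ0 : 0 < τ := by rw [hτ]; positivity
  have hi := integrable_min_shift (g := g) hφmono hφ0 hφ1 hτ0.le (M := M)
  have hi2 := integrable_min_shift_sq (g := g) hφmono hφ0 hφ1 hτ0.le (M := M)
  -- Quadratic near 0 and capped by the truncation, ψ∘φ is monotone and bounded, so the tail
  -- comparison moves its integral over y > y₀ into γ∫ψ(φ(y+M)), absorbed since 84m₁γ ≤ ε.
  set ψ : ℝ → ℝ := fun t => min (C * t ^ 2) (min t τ) with hψ
  have hψ0 : ∀ y, 0 ≤ ψ (φ y) := fun y => le_min (by positivity) (le_min (hφ0 y) hτ0.le)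
  have hψτ : ∀ y, ψ (φ y) ≤ τ := fun y => (min_le_right _ _).trans (min_le_right _ _)
  have hψmono : Monotone fun y => ψ (φ y) := fun a b h => by
    have h1 := hφmono h
    have h2 := hφ0 a
    exact min_le_min (by gcongr) (min_le_min_right _ h1)
  have hψMmono : Monotone fun y => ψ (φ (y + M)) := fun a b h => hψmono (by linarith)
  have hψint : Integrable (fun y => ψ (φ y)) g := integrable_of_mem_Icc hψmono.measurable hψ0 hψτ
  have hψMint : Integrable (fun y => ψ (φ (y + M))) g :=
    integrable_of_mem_Icc hψMmono.measurable (fun y => hψ0 _) fun y => hψτ _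
  have hφint : Integrable φ g := integrable_of_mem_Icc hφmono.measurable hφ0 hφ1
  have htailψ := setIntegral_Ioi_le_of_tail hψmono hψ0 hψτ hγ htail
  have hindint : Integrable (Set.indicator (Set.Ioi y₀) fun y => ψ (φ y)) g :=
    hψint.indicator measurableSet_Ioi
  have hI1 : Integrable (fun y => (1 + ε) * φ y - min (φ (y + M)) τ) g :=
    (hφint.const_mul _).sub hi
  have hI2 : Integrable (fun y => (1 + 32 * ε) * (C * φ y₀ ^ 2) +
      84 * m₁ * Set.indicator (Set.Ioi y₀) (fun y => ψ (φ y)) y) g :=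
    (integrable_const _).add (hindint.const_mul _)
  have h1 : ∫ y, ((1 + ε) * φ y - min (φ (y + M)) τ + m₁ * min (φ (y + M)) τ ^ 2) ∂g ≤
      ∫ y, (((1 + 32 * ε) * (C * φ y₀ ^ 2) +
        84 * m₁ * Set.indicator (Set.Ioi y₀) (fun y => ψ (φ y)) y) - ε * ψ (φ (y + M))) ∂g := by
    refine integral_mono (hI1.add (hi2.const_mul _)) (hI2.sub (hψMint.const_mul _)) fun y => ?_
    have hle : φ y ≤ φ (y + M) := hφmono (by linarith)
    simp only [Set.indicator_apply]
    split_ifs with hy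
    · have := truncated_defect_le hε0 hε hm1 hτ hC (hφ0 y) hle (hφ1 _) (hD y)
      have h2 : 0 ≤ (1 + 32 * ε) * (C * φ y₀ ^ 2) := by positivity
      simp only [hψ]
      linarith
    · have hy' : φ y ≤ φ y₀ := hφmono (not_lt.1 hy)
      have := truncated_defect_le_of_small hε0 hε hm1 hτ hC (hφ0 y) hle (hy'.trans hφ₀τ) (hD y)
      have h2 : (1 + 32 * ε) * (C * φ y ^ 2) ≤ (1 + 32 * ε) * (C * φ y₀ ^ 2) := by
        have := hφ0 y
        gcongr
      simp only [hψ]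
      linarith
  rw [integral_add hI1 (hi2.const_mul _), integral_sub (hφint.const_mul _) hi,
    integral_sub hI2 (hψMint.const_mul _),
    integral_add (integrable_const _) (hindint.const_mul _)] at h1
  simp only [integral_const_mul, integral_indicator measurableSet_Ioi, integral_const,
    probReal_univ, one_smul] at h1
  refine h1.trans ?_
  have h3 : 0 ≤ ∫ y, ψ (φ (y + M)) ∂g := integral_nonneg fun y => hψ0 _
  have h4 : 84 * m₁ * ∫ y in Set.Ioi y₀, ψ (φ y) ∂g ≤ 84 * m₁ * (γ * ∫ y, ψ (φ (y + M)) ∂g) :=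
    mul_le_mul_of_nonneg_left htailψ (by positivity)
  have h5 := mul_le_mul_of_nonneg_right hγε h3
  linarith

/-- The Lyapunov estimate: right tails of the recursion grow geometrically, up to a quadratic
error. -/
theorem IsStep.lyapunov {m₀ m₁ m : ℝ} {ν : Measure Offspring} {g : Measure ℝ}
    (H : IsStep m₀ m₁ ν g m) {F : ℝ → ℝ} (hF : Monotone F) (hF0 : ∀ x, 0 ≤ F x)
    (hF1 : ∀ x, F x ≤ 1) {ε C M B γ : ℝ} (hε0 : 0 < ε) (hε : ε ≤ 1 / 4)
    (hεm : (1 + 32 * ε) * ((1 + ε) / (1 - ε) ^ 2) ^ 2 ≤ m₀) (hC : C = 128 * m₁ / ε)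
    (hM : 0 ≤ M) (hB : 1 - ε ≤ g.real (Set.Ioi (-B))) (hγ : 0 ≤ γ) (hγε : 84 * m₁ * γ ≤ ε)
    (htail : ∀ z ≥ M - B, g.real (Set.Ici z) ≤ γ * g.real (Set.Ioi (z - M)))
    (ih : ∀ x, (1 + ε) * (1 - F x) - (1 - F (x - M)) ≤ C * (1 - F x) ^ 2) (x : ℝ) :
    (1 + ε) * (1 - recursionStep ν F x) - (1 - recursionStep ν F (x - M)) ≤
      C * (1 - recursionStep ν F x) ^ 2 := by
  have := H.prob
  have := H.prob_marginal
  have hm0 := H.one_lt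
  have hm0m := H.lt_mean
  have hmm1 := H.mean_le
  have hm1 : 1 ≤ m₁ := by linarith
  have hm1pos := H.second_pos
  have hC0 : 0 < C := by rw [hC]; positivity
  have hCε : C * ε = 128 * m₁ := by rw [hC]; field_simp
  have hu0 : 0 ≤ 1 - recursionStep ν F x := sub_nonneg.2 (H.recursionStep_le_one hF hF0 hF1 x)
  have hv0 : 0 ≤ 1 - recursionStep ν F (x - M) :=
    sub_nonneg.2 (H.recursionStep_le_one hF hF0 hF1 _)
  have hup := H.one_sub_recursionStep_le hF hF0 hF1 x
  have hlow {v : ℝ → ℝ} := H.le_one_sub_recursionStep hF hF0 hF1 (x - M) (v := v)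
  set u := 1 - recursionStep ν F x
  set w := 1 - recursionStep ν F (x - M)
  set φ : ℝ → ℝ := fun y => 1 - F (x - y) with hφ
  have hφmono : Monotone φ := fun a b h => sub_le_sub_left (hF (by linarith)) 1
  have hφ0 : ∀ y, 0 ≤ φ y := fun y => sub_nonneg.2 (hF1 _)
  have hφ1 : ∀ y, φ y ≤ 1 := fun y => by simp only [hφ]; linarith [hF0 (x - y)]
  have hφM : ∀ y, φ (y + M) = 1 - F (x - M - y) := fun y => by simp only [hφ]; ring_nf
  have hφMmono : Monotone fun y => φ (y + M) := fun a b h => hφmono (by linarith)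
  have hD : ∀ y, (1 + ε) * φ y - φ (y + M) ≤ C * φ y ^ 2 := fun y => by
    have := ih (x - y)
    rwa [show x - y - M = x - (y + M) by ring] at this
  -- For u ≥ 2/C the right side Cu² ≥ 2u already wins.
  rcases le_or_gt (2 / C) u with hbig | hsmall
  · have : 2 ≤ C * u := by rwa [div_le_iff₀' hC0] at hbig
    nlinarith
  rcases le_or_gt ((1 + ε) * u) w with hgrow | hflat
  · have : 0 ≤ C * u ^ 2 := by positivity
    linarith
  have hCu : C * u < 2 := by rwa [lt_div_iff₀' hC0] at hsmall
  set φ₀ := φ (M - B) with hφ₀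
  have htrunc (t : ℝ) (ht : 0 ≤ t) :
      m * ∫ y, min (φ (y + M)) t ∂g - m₁ * ∫ y, min (φ (y + M)) t ^ 2 ∂g ≤ w :=
    hlow (hφMmono.measurable.min measurable_const) (fun y => le_min (hφ0 _) ht)
      fun y => (min_le_left _ _).trans (hφM y).le
  -- Truncate at s = 8/C. If φ₀ ≥ s, then Cw ≥ 9/2, whereas w < (1+ε)u and Cu < 2 force Cw < 4. So
  -- the truncation is inactive at φ₀, which is then bounded linearly by u.
  have hφ₀u : φ₀ < 8 / C ∧ m * (1 - ε) ^ 2 * φ₀ ≤ (1 + ε) * u := by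
    set s := 8 / C with hs
    have hs0 : 0 < s := by positivity
    have hCs : C * s = 8 := by rw [hs]; field_simp
    have hm1s : m₁ * s ≤ ε := by
      have : C * ε * s = 8 * ε := by linear_combination ε * hCs
      rw [hCε] at this
      linarith
    have h7 := mul_min_le_of_truncated_le hφmono hφ0 hφ1 hs0.le (by linarith) hm1pos.le hε0 hε
      hm1s hB (htrunc s hs0.le)
    have hlt : φ₀ < s := by
      by_contra hge
      rw [min_eq_right (not_lt.1 hge)] at h7
      have h8 : 9 / 16 ≤ m * (1 - ε) ^ 2 := by
        have : (9 / 16 : ℝ) ≤ (1 - ε) ^ 2 := by nlinarith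
        nlinarith
      have h9 : 9 / 16 * s ≤ w := (mul_le_mul_of_nonneg_right h8 hs0.le).trans h7
      have h10 : (1 + ε) * u ≤ 2 * u := mul_le_mul_of_nonneg_right (by linarith) hu0
      have h11 : C * (9 / 16 * s) < C * (2 * u) :=
        mul_lt_mul_of_pos_left (by linarith) hC0
      linarith
    rw [min_eq_left hlt.le] at h7
    exact ⟨hlt, h7.trans hflat.le⟩
  obtain ⟨hφ₀s, hφ₀u⟩ := hφ₀u
  set τ := 1 / (4 * m₁) with hτ
  have hτ0 : 0 < τ := by positivity
  have hφ₀τ : φ₀ ≤ τ / 4 := by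
    refine hφ₀s.le.trans ?_
    rw [hC, hτ]
    rw [show (8 : ℝ) / (128 * m₁ / ε) = ε / (16 * m₁) by field_simp; norm_num,
      show 1 / (4 * m₁) / 4 = 1 / (16 * m₁) by field_simp; norm_num]
    gcongr
    linarith
  have hE := integral_truncated_defect_le hφmono hφ0 hφ1 hε0 hε hm1 hτ hC hM hγ hγε htail hD hφ₀τ
  have hmain : (1 + ε) * u - w ≤ m * ((1 + 32 * ε) * (C * φ₀ ^ 2)) := by
    have h1 := htrunc τ hτ0.le
    have h2 : m₁ * ∫ y, min (φ (y + M)) τ ^ 2 ∂g ≤ m * (m₁ * ∫ y, min (φ (y + M)) τ ^ 2 ∂g) :=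
      le_mul_of_one_le_left (mul_nonneg hm1pos.le (integral_nonneg fun y => sq_nonneg _))
        (by linarith)
    have h3 := mul_le_mul_of_nonneg_left hE (show 0 ≤ m by linarith)
    have h4 := mul_le_mul_of_nonneg_left hup (show 0 ≤ 1 + ε by linarith)
    linarith
  refine hmain.trans ?_
  have hm : 0 < m := by linarith
  have hκ : m * φ₀ ≤ (1 + ε) / (1 - ε) ^ 2 * u := by
    have : 0 < (1 - ε) ^ 2 := by
      have : 0 < 1 - ε := by linarith
      positivity
    rw [div_mul_eq_mul_div, le_div_iff₀ this]
    linarith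
  have h1 : (m * φ₀) ^ 2 ≤ ((1 + ε) / (1 - ε) ^ 2 * u) ^ 2 :=
    pow_le_pow_left₀ (mul_nonneg hm.le (hφ0 _)) hκ 2
  -- Supercriticality closes the induction here: squaring the bound on mφ₀ leaves a spare factor m,
  -- which beats the ε-losses by `hεm`.
  have h2 : (1 + 32 * ε) * (m * φ₀) ^ 2 ≤ m * u ^ 2 := by
    calc (1 + 32 * ε) * (m * φ₀) ^ 2
        ≤ (1 + 32 * ε) * ((1 + ε) / (1 - ε) ^ 2 * u) ^ 2 := by gcongr
      _ = (1 + 32 * ε) * ((1 + ε) / (1 - ε) ^ 2) ^ 2 * u ^ 2 := by ring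
      _ ≤ m * u ^ 2 := by
        refine mul_le_mul_of_nonneg_right (hεm.trans hm0m.le) (sq_nonneg u)
  have h3 : m * ((1 + 32 * ε) * φ₀ ^ 2) ≤ u ^ 2 := by
    refine le_of_mul_le_mul_left ?_ hm
    calc m * (m * ((1 + 32 * ε) * φ₀ ^ 2)) = (1 + 32 * ε) * (m * φ₀) ^ 2 := by ring
      _ ≤ m * u ^ 2 := h2
  calc m * ((1 + 32 * ε) * (C * φ₀ ^ 2)) = C * (m * ((1 + 32 * ε) * φ₀ ^ 2)) := by ring
    _ ≤ C * u ^ 2 := mul_le_mul_of_nonneg_left h3 hC0.le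

/-! ### Uniform tail estimates over admissible environments -/

/-- An offspring law with the moment bounds of `IsStep`, whose marginal has right tails decaying
at rate `a` and left tails controlled by `B`. -/
def Admissible (m₀ m₁ a M₀ : ℝ) (B : ℝ → ℝ) (ν : Measure Offspring) : Prop :=
  ∃ (g : Measure ℝ) (m : ℝ), IsStep m₀ m₁ ν g m ∧
    (∀ M x : ℝ, M₀ < M → 0 ≤ x → tail g (x + M) ≤ Real.exp (-a * M) * tail g x) ∧
    ∀ η > 0, 1 - η ≤ tail g (-B η)

theorem Admissible.isProbabilityMeasure {m₀ m₁ a M₀ : ℝ} {B : ℝ → ℝ} {ν : Measure Offspring}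
    (h : Admissible m₀ m₁ a M₀ B ν) : IsProbabilityMeasure ν := by
  obtain ⟨g, m, H, -⟩ := h
  exact H.prob

theorem tail_anti {g : Measure ℝ} [IsFiniteMeasure g] {x y : ℝ} (h : x ≤ y) :
    tail g y ≤ tail g x := measureReal_mono (Set.Ioi_subset_Ioi h)

theorem exists_small_parameter {m₀ : ℝ} (hm₀ : 1 < m₀) :
    ∃ ε > (0 : ℝ), ε ≤ 1 / 4 ∧ (1 + 32 * ε) * ((1 + ε) / (1 - ε) ^ 2) ^ 2 ≤ m₀ := by
  have hc : ContinuousAt (fun ε : ℝ => (1 + 32 * ε) * ((1 + ε) / (1 - ε) ^ 2) ^ 2) 0 := by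
    refine ContinuousAt.mul (by fun_prop) ((ContinuousAt.div (by fun_prop) (by fun_prop) ?_).pow 2)
    norm_num
  have h1 := (hc.eventually_lt (g := fun _ => m₀) continuousAt_const (by simpa using hm₀)).filter_mono
    (nhdsWithin_le_nhds (s := Set.Ioi 0))
  have h2 : ∀ᶠ ε : ℝ in nhdsWithin 0 (Set.Ioi 0), ε < 1 / 4 :=
    (eventually_lt_nhds (by norm_num)).filter_mono nhdsWithin_le_nhds
  obtain ⟨ε, ⟨h1, h2⟩, h3⟩ := ((h1.and h2).and self_mem_nhdsWithin).exists
  exact ⟨ε, h3, h2.le, h1.le⟩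

theorem exists_exp_le {a : ℝ} (ha : 0 < a) {c : ℝ} (hc : 0 < c) (M₀ : ℝ) :
    ∃ Y > M₀, 0 < Y ∧ Real.exp (-a * Y) ≤ c := by
  have h : Filter.Tendsto (fun Y : ℝ => Real.exp (-(a * Y))) Filter.atTop (nhds 0) :=
    Real.tendsto_exp_neg_atTop_nhds_zero.comp (Filter.tendsto_id.const_mul_atTop ha)
  obtain ⟨Y, ⟨h1, h2⟩, h3⟩ := (((h.eventually_lt_const hc).and
    (Filter.eventually_gt_atTop M₀)).and (Filter.eventually_gt_atTop 0)).exists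
  exact ⟨Y, h2, h3, by rw [neg_mul]; exact h1.le⟩

section family

variable {m₀ m₁ a M₀ : ℝ} {B : ℝ → ℝ}

theorem exists_lyapunov (hm₀ : 1 < m₀) (hm₁ : 0 < m₁) (ha : 0 < a) (hB : ∀ η > 0, 0 < B η) :
    ∃ ε > (0 : ℝ), ∃ C > (0 : ℝ), ∃ M > (0 : ℝ), ∀ L : ℕ → Measure Offspring,
      (∀ j, Admissible m₀ m₁ a M₀ B (L j)) → ∀ n x,
        (1 + ε) * (1 - maxCDF L n x) - (1 - maxCDF L n (x - M)) ≤ C * (1 - maxCDF L n x) ^ 2 := by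
  obtain ⟨ε, hε0, hε, hεm⟩ := exists_small_parameter hm₀
  have hC : 0 < 128 * m₁ / ε := by positivity
  obtain ⟨Y, hYM, hY0, hY⟩ := exists_exp_le ha (show 0 < ε / (84 * m₁) by positivity) M₀
  have hBε := hB ε hε0
  -- With M = Y + B ε + 1 the far region starts at M - B ε = Y + 1. The 1 pays for replacing a
  -- closed ray by an open one, and Y exceeds `M₀`, so the decay can be applied from max(z-M, 0) up
  -- to z-1.
  refine ⟨ε, hε0, 128 * m₁ / ε, hC, Y + B ε + 1, by positivity, fun L hL n => ?_⟩
  induction n generalizing L with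
  | zero =>
    intro x
    have hmono : maxCDF L 0 (x - (Y + B ε + 1)) ≤ maxCDF L 0 x := by
      have := fun j => (hL j).isProbabilityMeasure
      exact monotone_maxCDF L 0 (by linarith)
    by_cases h : 0 ≤ x
    · have h1 : maxCDF L 0 x = 1 := by simp [maxCDF, h]
      rw [h1] at hmono ⊢
      norm_num
      exact hmono
    · have h1 : maxCDF L 0 x = 0 := by simp [maxCDF, h]
      have h2 : maxCDF L 0 (x - (Y + B ε + 1)) = 0 := by
        have : ¬ (Y + B ε + 1 ≤ x) := by linarith
        simp [maxCDF, this]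
      rw [h1, h2]
      have : 1 ≤ m₁ := by
        obtain ⟨g, m, H, -⟩ := hL 0
        linarith [H.mean_le, H.lt_mean]
      have : ε ≤ 128 * m₁ / ε := by
        rw [le_div_iff₀ hε0]
        nlinarith
      linarith
  | succ n ih =>
    have := fun j => (hL j).isProbabilityMeasure
    obtain ⟨g, m, H, hright, hleft⟩ := hL 0
    have := H.prob_marginal
    refine H.lyapunov (monotone_maxCDF _ n) (maxCDF_nonneg _ n) (maxCDF_le_one _ n) hε0 hε hεm rfl
      (by positivity) (hleft ε hε0) (Real.exp_nonneg (-a * Y)) ?_ ?_ (ih _ fun j => hL (j + 1))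
    · calc 84 * m₁ * Real.exp (-a * Y) ≤ 84 * m₁ * (ε / (84 * m₁)) := by gcongr
        _ = ε := by field_simp
    · intro z hz
      have h1 : g.real (Set.Ici z) ≤ tail g (z - 1) :=
        measureReal_mono fun y hy => by
          have : z ≤ y := hy
          show z - 1 < y
          linarith
      refine h1.trans ?_
      rcases le_or_gt 0 (z - (Y + B ε + 1)) with h | h
      · have h2 := hright (Y + B ε) _ (by linarith) h
        rw [show z - (Y + B ε + 1) + (Y + B ε) = z - 1 by ring] at h2
        refine h2.trans (mul_le_mul_of_nonneg_right (Real.exp_le_exp.2 ?_) measureReal_nonneg)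
        nlinarith
      · have h2 := hright (z - 1) 0 (by linarith) le_rfl
        rw [zero_add] at h2
        refine h2.trans (mul_le_mul (Real.exp_le_exp.2 ?_) (tail_anti h.le) measureReal_nonneg
          (Real.exp_nonneg _))
        nlinarith

/-- For u ≤ ε/(2C) the quadratic term is at most (ε/2)u, so each step of length M to the right
divides u by at least 1+ε/2. -/
theorem pow_mul_le_of_lyapunov {u : ℝ → ℝ} (hu : Antitone u) (hu0 : ∀ x, 0 ≤ u x) {ε C M δ : ℝ}
    (hC : 0 < C) (hM : 0 < M) (hδ : δ ≤ ε / (2 * C))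
    (h : ∀ x, (1 + ε) * u x - u (x - M) ≤ C * u x ^ 2) {x : ℝ} (hx : u x ≤ δ) (k : ℕ) :
    (1 + ε / 2) ^ k * u (x + k * M) ≤ δ := by
  have hδ0 : 0 ≤ δ := (hu0 x).trans hx
  have hε0 : 0 ≤ ε := by
    have := (div_nonneg_iff.1 (hδ0.trans hδ)).resolve_right fun h => by linarith
    exact this.1
  induction k with
  | zero => simpa using hx
  | succ k ih =>
    have h1 := h (x + (k + 1 : ℕ) * M)
    rw [show x + (k + 1 : ℕ) * M - M = x + k * M by push_cast; ring] at h1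
    have h2 : u (x + (k + 1 : ℕ) * M) ≤ ε / (2 * C) :=
      ((hu (by linarith [mul_nonneg (Nat.cast_nonneg (α := ℝ) (k + 1)) hM.le])).trans hx).trans hδ
    set v := u (x + (k + 1 : ℕ) * M)
    have hv : 0 ≤ v := hu0 _
    rw [le_div_iff₀ (by positivity)] at h2
    have h3 : (1 + ε / 2) * v ≤ u (x + k * M) := by nlinarith
    calc (1 + ε / 2) ^ (k + 1) * v = (1 + ε / 2) ^ k * ((1 + ε / 2) * v) := by ring
      _ ≤ (1 + ε / 2) ^ k * u (x + k * M) := by gcongr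
      _ ≤ δ := ih

/-- Beyond the `δ`-quantile the right tails decay uniformly. -/
theorem exists_right_tail (hm₀ : 1 < m₀) (hm₁ : 0 < m₁) (ha : 0 < a) (hB : ∀ η > 0, 0 < B η) :
    ∃ δ > (0 : ℝ), δ ≤ 1 / 2 ∧ ∀ η > 0, ∃ R > 0, ∀ L : ℕ → Measure Offspring,
      (∀ j, Admissible m₀ m₁ a M₀ B (L j)) → ∀ n x,
        1 - maxCDF L n x ≤ δ → 1 - maxCDF L n (x + R) ≤ η := by
  obtain ⟨ε, hε, C, hC, M, hM, h⟩ := exists_lyapunov (M₀ := M₀) hm₀ hm₁ ha hB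
  refine ⟨min (ε / (2 * C)) (1 / 2), lt_min (by positivity) (by norm_num), min_le_right _ _,
    fun η hη => ?_⟩
  obtain ⟨k, hk⟩ := pow_unbounded_of_one_lt (1 / η) (show 1 < 1 + ε / 2 by linarith)
  refine ⟨(k + 1 : ℕ) * M, by positivity, fun L hL n x hx => ?_⟩
  have := fun j => (hL j).isProbabilityMeasure
  have h1 := pow_mul_le_of_lyapunov (u := fun x => 1 - maxCDF L n x)
    (fun x y hxy => sub_le_sub_left (monotone_maxCDF L n hxy) 1)
    (fun x => sub_nonneg.2 (maxCDF_le_one L n x)) hC hM (min_le_left _ _) (h L hL n) hx (k + 1)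
  have h2 : 0 ≤ 1 - maxCDF L n (x + (k + 1 : ℕ) * M) := sub_nonneg.2 (maxCDF_le_one L n _)
  set v := 1 - maxCDF L n (x + (k + 1 : ℕ) * M)
  have h3 : 1 / η ≤ (1 + ε / 2) ^ (k + 1) :=
    hk.le.trans (pow_le_pow_right₀ (by linarith) k.le_succ)
  have h4 : 1 / η * v ≤ 1 := by
    refine (mul_le_mul_of_nonneg_right h3 h2).trans (h1.trans ((min_le_right _ _).trans ?_))
    norm_num
  rw [div_mul_eq_mul_div, div_le_one hη, one_mul] at h4
  exact h4

/-- The `δ`-quantiles of consecutive iterates are comparable. -/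
theorem exists_quantile_shift (hm₁ : 0 < m₁) (ha : 0 < a) {δ : ℝ} (hδ : 0 < δ)
    (h : ∀ η > 0, ∃ R > 0, ∀ L : ℕ → Measure Offspring,
      (∀ j, Admissible m₀ m₁ a M₀ B (L j)) → ∀ n x,
        1 - maxCDF L n x ≤ δ → 1 - maxCDF L n (x + R) ≤ η) :
    ∃ c > (0 : ℝ), ∀ L : ℕ → Measure Offspring, (∀ j, Admissible m₀ m₁ a M₀ B (L j)) → ∀ n x,
      δ ≤ 1 - maxCDF L (n + 1) x → δ ≤ 1 - maxCDF (fun j => L (j + 1)) n (x - c) := by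
  -- If the conclusion failed, a child's subtree at level x-b and a displacement beyond b would each
  -- contribute at most m₁·δ/(4m₁), giving δ/2 < δ in total.
  have hη : 0 < δ / (4 * m₁) := by positivity
  obtain ⟨R, hR, h⟩ := h _ hη
  obtain ⟨b, hbM, hb0, hb⟩ := exists_exp_le ha hη M₀
  refine ⟨R + b, by positivity, fun L hL n x hx => ?_⟩
  by_contra! hlt
  have := fun j => (hL j).isProbabilityMeasure
  have h1 := h (fun j => L (j + 1)) (fun j => hL (j + 1)) n _ hlt.le
  rw [show x - (R + b) + R = x - b by ring] at h1
  obtain ⟨g, m, H, hright, -⟩ := hL 0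
  have := H.prob_marginal
  have hmono := monotone_maxCDF (fun j => L (j + 1)) n
  have hle1 := maxCDF_le_one (fun j => L (j + 1)) n
  have hge0 := maxCDF_nonneg (fun j => L (j + 1)) n
  have h2 := H.one_sub_recursionStep_le hmono hge0 hle1 x
  change 1 - maxCDF L (n + 1) x ≤ _ at h2
  set F := maxCDF (fun j => L (j + 1)) n
  have h3 : ∫ y, (1 - F (x - y)) ∂g ≤ (1 - F (x - b)) + tail g b := by
    have h4 : ∫ y, (1 - F (x - y)) ∂g ≤
        ∫ y, ((1 - F (x - b)) + Set.indicator (Set.Ioi b) (fun _ => (1 : ℝ)) y) ∂g := by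
      refine integral_mono (integrable_of_mem_Icc (c := 1) ?_ (fun y => sub_nonneg.2 (hle1 _))
        fun y => by linarith [hge0 (x - y)]) ((integrable_const _).add
          ((integrable_const _).indicator measurableSet_Ioi)) fun y => ?_
      · exact measurable_const.sub (hmono.measurable.comp (measurable_const.sub measurable_id))
      · simp only [Set.indicator_apply]
        split_ifs with hy
        · linarith [hge0 (x - y), hle1 (x - b)]
        · have : F (x - b) ≤ F (x - y) := hmono (by linarith [Set.notMem_Ioi.1 hy])
          linarith
    rw [integral_add (integrable_const _) ((integrable_const _).indicator measurableSet_Ioi),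
      integral_indicator_const _ measurableSet_Ioi] at h4
    simpa [tail] using h4
  have h5 : tail g b ≤ δ / (4 * m₁) := by
    have := hright b 0 hbM le_rfl
    rw [zero_add] at this
    have h0 : tail g 0 ≤ 1 := measureReal_le_one
    calc tail g b ≤ Real.exp (-a * b) * tail g 0 := this
      _ ≤ Real.exp (-a * b) * 1 := by gcongr
      _ ≤ _ := by rwa [mul_one]
  have h6 : m * ∫ y, (1 - F (x - y)) ∂g ≤ m₁ * (δ / (4 * m₁) + δ / (4 * m₁)) :=
    mul_le_mul H.mean_le (by linarith) (integral_nonneg fun y => sub_nonneg.2 (hle1 _)) hm₁.le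
  have h7 : m₁ * (δ / (4 * m₁) + δ / (4 * m₁)) = δ / 2 := by field_simp; norm_num
  linarith

/-- On the left of the `δ`-quantile the left tails decay uniformly. -/
theorem exists_left_tail (hm₀ : 1 < m₀) (hm₁ : 0 < m₁) (hB : ∀ η > 0, 0 < B η) {δ c : ℝ}
    (hδ : 0 < δ) (hc : 0 < c)
    (h : ∀ L : ℕ → Measure Offspring, (∀ j, Admissible m₀ m₁ a M₀ B (L j)) → ∀ n x,
      δ ≤ 1 - maxCDF L (n + 1) x → δ ≤ 1 - maxCDF (fun j => L (j + 1)) n (x - c))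
    {η : ℝ} (hη : 0 < η) (hηδ : η ≤ 1 - δ) :
    ∃ R ≥ (0 : ℝ), ∀ L : ℕ → Measure Offspring, (∀ j, Admissible m₀ m₁ a M₀ B (L j)) → ∀ n x,
      δ ≤ 1 - maxCDF L n x → maxCDF L n (x - R) ≤ η := by
  set c₀ := (m₀ - 1) ^ 2 / m₁ with hc₀
  have hc₀pos : 0 < c₀ := div_pos (pow_pos (by linarith) 2) hm₁
  -- For f in [η, 1-δ] branching gains at least c₀ηδ = 2d; half of it is spent on the displacement
  -- error, leaving a net gain d per generation.
  set d := c₀ * (η * δ) / 2 with hd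
  have hd0 : 0 < d := by positivity
  -- Here k counts generations traversed. It is independent of n; if time 0 is reached first, the
  -- point lies left of the root and the bound is trivial.
  have key : ∀ k : ℕ, ∃ R ≥ (0 : ℝ), ∀ L : ℕ → Measure Offspring,
      (∀ j, Admissible m₀ m₁ a M₀ B (L j)) → ∀ n x,
        δ ≤ 1 - maxCDF L n x → maxCDF L n (x - R) ≤ max η (1 - δ - k * d) := by
    intro k
    induction k with
    | zero =>
      refine ⟨0, le_rfl, fun L hL n x hx => ?_⟩
      rw [sub_zero]
      refine le_max_of_le_right ?_
      push_cast
      linarith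
    | succ k ih =>
      obtain ⟨R, hR, ih⟩ := ih
      have hη' : 0 < d / m₁ := by positivity
      have hBη := hB _ hη'
      refine ⟨c + R + B (d / m₁), by positivity, fun L hL n x hx => ?_⟩
      rcases n with _ | n
      · have hx0 : x < 0 := by
          by_contra! h0
          have : maxCDF L 0 x = 1 := by simp [maxCDF, h0]
          linarith
        have : maxCDF L 0 (x - (c + R + B (d / m₁))) = 0 := by
          have : ¬ (c + R + B (d / m₁) ≤ x) := by linarith
          simp [maxCDF, this]
        rw [this]
        exact le_max_of_le_left hη.le
      · have := fun j => (hL j).isProbabilityMeasure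
        have h1 := ih _ (fun j => hL (j + 1)) n _ (h L hL n x hx)
        obtain ⟨g, m, H, -, hleft⟩ := hL 0
        have := H.prob_marginal
        set f := max η (1 - δ - k * d)
        have hkd : 0 ≤ k * d := by positivity
        have hf1 : f ≤ 1 - δ := max_le hηδ (by linarith)
        have hfη : η ≤ f := le_max_left _ _
        have h2 := H.recursionStep_le (monotone_maxCDF _ n) (maxCDF_nonneg _ n)
          (maxCDF_le_one _ n) (B := B (d / m₁)) h1 (by linarith)
        have h3 : g.real (Set.Iic (-B (d / m₁))) ≤ d / m₁ := by
          have h4 := hleft _ hη'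
          have h5 := probReal_compl_eq_one_sub (μ := g)
            (measurableSet_Ioi (a := -B (d / m₁)))
          rw [Set.compl_Ioi] at h5
          unfold tail at h4
          linarith
        have h4 : m₁ * g.real (Set.Iic (-B (d / m₁))) ≤ d := by
          rwa [le_div_iff₀' hm₁] at h3
        have h5 : 2 * d ≤ c₀ * (f * (1 - f)) := by
          rw [hd, mul_div_cancel₀ _ two_ne_zero]
          gcongr
          linarith
        have h6 : f - d ≤ max η (1 - δ - (k + 1 : ℕ) * d) := by
          rcases max_choice η (1 - δ - k * d) with h | h
          · exact le_max_of_le_left (by linarith [show f = η from h])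
          · refine le_max_of_le_right ?_
            rw [show f = 1 - δ - k * d from h]
            push_cast
            linarith
        change recursionStep (L 0) (maxCDF (fun j => L (j + 1)) n) _ ≤ _
        rw [show x - (c + R + B (d / m₁)) = x - c - R - B (d / m₁) by ring]
        linarith
  obtain ⟨k, hk⟩ := exists_nat_ge ((1 - δ) / d)
  obtain ⟨R, hR, h⟩ := key k
  refine ⟨R, hR, fun L hL n x hx => (h L hL n x hx).trans (max_le le_rfl ?_)⟩
  rw [div_le_iff₀ hd0] at hk
  linarith

/-- The distribution functions `maxCDF L n` are uniformly tight around their medians. -/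
theorem exists_tightness_bound (hm₀ : 1 < m₀) (hm₁ : 0 < m₁) (ha : 0 < a)
    (hB : ∀ η > 0, 0 < B η) {η : ℝ} (hη : 0 < η) :
    ∃ R > (0 : ℝ), ∀ L : ℕ → Measure Offspring, (∀ j, Admissible m₀ m₁ a M₀ B (L j)) → ∀ n x,
      (1 / 2 ≤ maxCDF L n x → 1 - maxCDF L n (x + R) ≤ η) ∧
        (maxCDF L n x ≤ 1 / 2 → maxCDF L n (x - R) ≤ η) := by
  obtain ⟨δ, hδ, hδ2, hright⟩ := exists_right_tail (M₀ := M₀) hm₀ hm₁ ha hB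
  obtain ⟨c, hc, hshift⟩ := exists_quantile_shift hm₁ ha hδ hright
  obtain ⟨R₁, hR₁, h₁⟩ := hright η hη
  -- Any level below 1/2 would do: a δ-quantile further than R₂ to the right of x would force F(x) ≤
  -- 1/4, contradicting F(x) ≥ 1/2.
  obtain ⟨R₂, hR₂, h₂⟩ := exists_left_tail hm₀ hm₁ hB hδ hc hshift (η := 1 / 4) (by norm_num)
    (by linarith)
  obtain ⟨R₃, hR₃, h₃⟩ := exists_left_tail hm₀ hm₁ hB hδ hc hshift (η := min η (1 / 4))
    (lt_min hη (by norm_num)) ((min_le_right _ _).trans (by linarith))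
  refine ⟨R₁ + R₂ + R₃, by positivity, fun L hL n x => ⟨fun hx => ?_, fun hx => ?_⟩⟩
  · have := fun j => (hL j).isProbabilityMeasure
    have h4 : 1 - maxCDF L n (x + R₂) ≤ δ := by
      by_contra! hlt
      have := h₂ L hL n _ hlt.le
      rw [add_sub_cancel_right] at this
      linarith
    have h5 := h₁ L hL n _ h4
    have h6 : maxCDF L n (x + R₂ + R₁) ≤ maxCDF L n (x + (R₁ + R₂ + R₃)) :=
      monotone_maxCDF L n (by linarith)
    linarith
  · have := fun j => (hL j).isProbabilityMeasure
    have h4 := h₃ L hL n x (by linarith)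
    have h5 : maxCDF L n (x - (R₁ + R₂ + R₃)) ≤ maxCDF L n (x - R₃) :=
      monotone_maxCDF L n (by linarith)
    exact (h5.trans h4).trans (min_le_left _ _)

end family

/-! ### Offspring laws satisfy the one-step hypotheses -/

section

variable {p : PMF ℕ} {G : (k : ℕ) → Measure (Fin k → ℝ)}

theorem measurable_sigma_mk (k : ℕ) : Measurable fun y : Fin k → ℝ => (⟨k, y⟩ : Offspring) :=
  measurable_sigma_iff.1 measurable_id k

theorem lintegral_offspringLaw {f : Offspring → ℝ≥0∞} (hf : Measurable f) :
    ∫⁻ s, f s ∂(offspringLaw p G) = ∑' k, p k * ∫⁻ y, f ⟨k, y⟩ ∂(G k) := by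
  simp only [offspringLaw, lintegral_sum_measure, lintegral_smul_measure, smul_eq_mul]
  refine tsum_congr fun k => ?_
  rw [← lintegral_map hf (measurable_sigma_mk k)]

theorem isProbabilityMeasure_offspringLaw (hG : ∀ k, IsProbabilityMeasure (G k)) :
    IsProbabilityMeasure (offspringLaw p G) := by
  refine ⟨?_⟩
  rw [← lintegral_one, lintegral_offspringLaw measurable_const]
  simp [p.tsum_coe]

theorem ae_offspringLaw_ne_zero (hp : p 0 = 0) : ∀ᵐ s ∂(offspringLaw p G), s.1 ≠ 0 := by
  refine Measure.ae_sum_iff.2 fun k => ?_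
  rcases eq_or_ne k 0 with rfl | hk
  · simp [hp]
  · refine Measure.ae_smul_measure ?_ _
    exact (ae_map_iff (measurable_sigma_mk k).aemeasurable
      (measurable_fst (measurableSet_singleton 0).compl)).2 (.of_forall fun _ => hk)

theorem isProbabilityMeasure_marginal {k : ℕ} (hk : k ≠ 0) (ν : Measure (Fin k → ℝ))
    [IsProbabilityMeasure ν] : IsProbabilityMeasure (marginal ν) := by
  refine ⟨?_⟩
  have h (i : Fin k) : (ν.map fun y => y i) Set.univ = 1 := by
    rw [Measure.map_apply (measurable_pi_apply i) .univ]
    simp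
  simp only [marginal, Measure.smul_apply, Measure.finsetSum_apply, h, Finset.sum_const,
    Finset.card_univ, Fintype.card_fin, smul_eq_mul, nsmul_eq_mul, mul_one]
  exact ENNReal.inv_mul_cancel (by exact_mod_cast hk) (ENNReal.natCast_ne_top k)

theorem lintegral_sum_disp {k : ℕ} (hk : k ≠ 0) (ν : Measure (Fin k → ℝ)) {h : ℝ → ℝ≥0∞}
    (hh : Measurable h) :
    ∫⁻ y, ∑ i ∈ Finset.range k, h (disp ⟨k, y⟩ i) ∂ν = k * ∫⁻ x, h x ∂(marginal ν) := by
  have h1 (y : Fin k → ℝ) : ∑ i ∈ Finset.range k, h (disp ⟨k, y⟩ i) = ∑ i : Fin k, h (y i) := by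
    rw [Finset.sum_range]
    simp [disp]
  have h2 (i : Fin k) : Measurable fun y : Fin k → ℝ => h (y i) := hh.comp (measurable_pi_apply i)
  simp_rw [h1]
  rw [lintegral_finsetSum _ fun i _ => h2 i, marginal,
    lintegral_smul_measure, lintegral_finsetSum_measure, smul_eq_mul, ← mul_assoc,
    ENNReal.mul_inv_cancel (by exact_mod_cast hk) (ENNReal.natCast_ne_top k), one_mul]
  exact Finset.sum_congr rfl fun i _ => (lintegral_map hh (measurable_pi_apply i)).symm

/-- Given K = k, the sum has mean k∫h d(marginal). As the marginal is the same for all relevant k,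
the integral factors; weights 1 and k produce the first and second moments of K. -/
theorem lintegral_offspringLaw_weighted_sum (hp : p 0 = 0) {g : Measure ℝ}
    (hg : ∀ k, p k ≠ 0 → marginal (G k) = g) (w : ℕ → ℝ≥0∞) {h : ℝ → ℝ≥0∞} (hh : Measurable h) :
    ∫⁻ s, w s.1 * ∑ i ∈ Finset.range s.1, h (disp s i) ∂(offspringLaw p G) =
      (∑' k : ℕ, w k * k * p k) * ∫⁻ y, h y ∂g := by
  have hw : Measurable fun s : Offspring =>
      w s.1 * ∑ i ∈ Finset.range s.1, h (disp s i) :=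
    ((measurable_from_nat (f := w)).comp measurable_fst).mul (measurable_sum_disp hh)
  rw [lintegral_offspringLaw hw, ← ENNReal.tsum_mul_right]
  refine tsum_congr fun k => ?_
  rcases eq_or_ne (p k) 0 with hk | hk
  · simp [hk]
  have hk0 : k ≠ 0 := by
    rintro rfl
    exact hk hp
  have hm : Measurable fun y : Fin k → ℝ => ∑ i ∈ Finset.range k, h (disp ⟨k, y⟩ i) :=
    measurable_sigma_iff.1 (measurable_sum_disp hh) k
  dsimp only
  rw [lintegral_const_mul _ hm, lintegral_sum_disp hk0 _ hh, hg k hk]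
  ring

theorem isStep_offspringLaw (hp : p 0 = 0) (hG : ∀ k, IsProbabilityMeasure (G k)) {m₀ m₁ : ℝ≥0}
    (hm₀ : 1 < m₀) (hmean : (m₀ : ℝ≥0∞) < ∑' k : ℕ, (k : ℝ≥0∞) * p k)
    (hsecond : ∑' k : ℕ, (k : ℝ≥0∞) ^ 2 * p k < (m₁ : ℝ≥0∞)) {g : Measure ℝ}
    (hg : ∀ k, p k ≠ 0 → marginal (G k) = g) :
    IsStep m₀ m₁ (offspringLaw p G) g (∑' k : ℕ, (k : ℝ≥0∞) * p k).toReal where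
  prob := isProbabilityMeasure_offspringLaw hG
  prob_marginal := by
    obtain ⟨k, hk⟩ := p.support_nonempty
    have hk' : p k ≠ 0 := (p.mem_support_iff k).1 hk
    rw [← hg k hk']
    have := hG k
    refine isProbabilityMeasure_marginal ?_ _
    rintro rfl
    exact hk' hp
  ne_zero := ae_offspringLaw_ne_zero hp
  one_lt := by exact_mod_cast hm₀
  lt_mean := by
    have hfin : ∑' k : ℕ, (k : ℝ≥0∞) * p k ≠ ∞ := by
      refine ne_top_of_le_ne_top (hsecond.trans ENNReal.coe_lt_top).ne
        (ENNReal.tsum_le_tsum fun k => ?_)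
      gcongr
      exact_mod_cast Nat.le_self_pow two_ne_zero k
    have := (ENNReal.toReal_lt_toReal ENNReal.coe_ne_top hfin).2 hmean
    simpa using this
  second_pos := by
    have : (0 : ℝ≥0∞) < m₁ := bot_le.trans_lt hsecond
    exact_mod_cast this
  lintegral_sum h hh := by
    have hfin : ∑' k : ℕ, (k : ℝ≥0∞) * p k ≠ ∞ := by
      refine ne_top_of_le_ne_top (hsecond.trans ENNReal.coe_lt_top).ne
        (ENNReal.tsum_le_tsum fun k => ?_)
      gcongr
      exact_mod_cast Nat.le_self_pow two_ne_zero k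
    rw [ENNReal.ofReal_toReal hfin]
    simpa using lintegral_offspringLaw_weighted_sum hp hg (fun _ => 1) hh
  lintegral_mul_sum h hh := by
    rw [lintegral_offspringLaw_weighted_sum hp hg (fun k => k) hh, ENNReal.ofReal_coe_nnreal]
    gcongr
    simpa [sq] using hsecond.le

end

/-! ### Tightness around medians and conclusion -/

/-- Laws on `ℝ` whose distribution functions have uniform decay on both sides of any median are
tight after recentering at medians. -/
theorem isTightMeasureSet_recentered {ι : Type*} {ν : ι → Measure ℝ}
    [∀ i, IsProbabilityMeasure (ν i)] {med : ι → ℝ} (hmed : ∀ i, IsMedian (ν i) (med i))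
    (h : ∀ η > (0 : ℝ), ∃ R > (0 : ℝ), ∀ i x,
      (1 / 2 ≤ (ν i).real (Set.Iic x) → 1 - (ν i).real (Set.Iic (x + R)) ≤ η) ∧
        ((ν i).real (Set.Iic x) ≤ 1 / 2 → (ν i).real (Set.Iic (x - R)) ≤ η)) :
    IsTightMeasureSet (Set.range fun i => (ν i).map fun y => y - med i) := by
  refine isTightMeasureSet_iff_exists_isCompact_measure_compl_le.2 fun ε hε => ?_
  obtain ⟨r, hr0, hr⟩ := ENNReal.lt_iff_exists_nnreal_btwn.1 hε
  have hr0' : (0 : ℝ) < r := by exact_mod_cast hr0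
  obtain ⟨R, hR, h⟩ := h (r / 2) (half_pos hr0')
  -- The extra 1 on the left is due to atoms: a median only guarantees mass at most 1/2 strictly
  -- below it, so the left estimate is applied at `med i - 1`.
  refine ⟨Set.Icc (-(1 + R)) R, isCompact_Icc, ?_⟩
  rintro _ ⟨i, rfl⟩
  refine le_trans ?_ hr.le
  have hm : Measurable fun y : ℝ => y - med i := measurable_id.sub_const _
  rw [Measure.map_apply hm measurableSet_Icc.compl]
  have hsub : (fun y : ℝ => y - med i) ⁻¹' (Set.Icc (-(1 + R)) R)ᶜ ⊆
      Set.Iic (med i - 1 - R) ∪ (Set.Iic (med i + R))ᶜ := by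
    intro y hy
    by_contra hc
    simp only [Set.mem_union, Set.mem_Iic, Set.mem_compl_iff, not_or, not_le] at hc
    exact hy ⟨by linarith [hc.1], by linarith [hc.2]⟩
  have h1 := (h i (med i)).1 (hmed i).1
  have h2 := (h i (med i - 1)).2 (by
    have h3 := (hmed i).2
    have h4 := probReal_compl_eq_one_sub (μ := ν i) (measurableSet_Ici (a := med i))
    rw [Set.compl_Ici] at h4
    have h5 : (ν i).real (Set.Iic (med i - 1)) ≤ (ν i).real (Set.Iio (med i)) :=
      measureReal_mono fun y hy => by
        have : y ≤ med i - 1 := hy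
        show y < med i
        linarith
    linarith)
  have h6 : (ν i).real ((fun y : ℝ => y - med i) ⁻¹' (Set.Icc (-(1 + R)) R)ᶜ) ≤ r := by
    refine (measureReal_mono hsub).trans ((measureReal_union_le _ _).trans ?_)
    rw [probReal_compl_eq_one_sub measurableSet_Iic]
    linarith
  rw [← ofReal_measureReal, ← ENNReal.ofReal_coe_nnreal]
  exact ENNReal.ofReal_le_ofReal h6

end GBRW

end

theorem theorem2
    -- branching rules and displacement laws
    (p : ℕ → PMF ℕ) (hp : ∀ n, p n 0 = 0)
    (G : (n k : ℕ) → Measure (Fin k → ℝ)) (hG : ∀ n k, IsProbabilityMeasure (G n k))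
    -- mean offspring bounded away from one, bounded second moment
    (m₀ m₁ : ℝ≥0) (hm₀ : 1 < m₀)
    (hmean : (m₀ : ℝ≥0∞) < ⨅ n, ∑' k : ℕ, (k : ℝ≥0∞) * p n k)
    (hsecond : ⨆ n, ∑' k : ℕ, (k : ℝ≥0∞) ^ 2 * p n k < (m₁ : ℝ≥0∞))
    -- the marginals at time n do not depend on the number of children
    (g : ℕ → Measure ℝ) (hg : ∀ n k, p n k ≠ 0 → GBRW.marginal (G n k) = g n)
    -- not too much mass of the marginals drifts to the left
    (hleft : ∃ ε₀ : ℝ, ε₀ < min (1 / 4 * Real.log m₀) 1 ∧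
      ∃ x₀ : ℝ, ∀ n, 1 - ε₀ ≤ GBRW.tail (g n) x₀)
    -- exponential decay of the right tails of the marginals
    (hright : ∃ a > (0 : ℝ), ∃ M₀ > (0 : ℝ), ∀ (n : ℕ) (M x : ℝ), M₀ < M → 0 ≤ x →
      GBRW.tail (g n) (x + M) ≤ Real.exp (-a * M) * GBRW.tail (g n) x)
    -- global tightness of the displacements
    (htight : ∀ η₁ > (0 : ℝ), ∃ B > (0 : ℝ),
      (∀ n k, p n k ≠ 0 → 1 - η₁ ≤ (G n k).real (Set.Iic fun _ => B)) ∧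
      ∀ n, 1 - η₁ ≤ GBRW.tail (g n) (-B))
    -- the generalized branching random walk
    {Ω : Type*} [MeasurableSpace Ω] (μ : Measure Ω) [IsProbabilityMeasure μ]
    (ξ : List ℕ → Ω → GBRW.Offspring) (hξ : GBRW.IsGBRW μ p G ξ) :
    (∀ n, AEMeasurable (GBRW.maximum ξ n) μ) ∧
    ∀ med : ℕ → ℝ, (∀ n, GBRW.IsMedian (GBRW.maximumLaw μ ξ n) (med n)) →
      IsTightMeasureSet
        (Set.range fun n => (GBRW.maximumLaw μ ξ n).map fun y => y - med n) := by
  refine ⟨fun n => hξ.aemeasurable_maximum n, fun med hmed => ?_⟩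
  obtain ⟨a, ha, M₀, -, hright⟩ := hright
  choose! B hB0 hB using htight
  have hadm : ∀ j, GBRW.Admissible m₀ m₁ a M₀ B (GBRW.offspringLaw (p j) (G j)) := fun j =>
    ⟨g j, _, GBRW.isStep_offspringLaw (hp j) (hG j) hm₀ (hmean.trans_le (iInf_le _ j))
      ((le_iSup (fun n => ∑' k : ℕ, (k : ℝ≥0∞) ^ 2 * p n k) j).trans_lt hsecond) (hg j),
      hright j, fun η hη => (hB η hη).2 j⟩
  have := fun j => (hadm j).isProbabilityMeasure
  have hm₁ : (0 : ℝ) < m₁ := by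
    have : (0 : ℝ≥0∞) < m₁ := bot_le.trans_lt hsecond
    exact_mod_cast this
  have (n : ℕ) : IsProbabilityMeasure (GBRW.maximumLaw μ ξ n) :=
    Measure.isProbabilityMeasure_map (hξ.aemeasurable_maximum n)
  refine GBRW.isTightMeasureSet_recentered hmed fun η hη => ?_
  obtain ⟨R, hR, h⟩ := GBRW.exists_tightness_bound (M₀ := M₀) (by exact_mod_cast hm₀) hm₁ ha hB0 hη
  refine ⟨R, hR, fun n x => ?_⟩
  simp only [hξ.maximumLaw_Iic fun j => GBRW.ae_offspringLaw_ne_zero (hp j)]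
  exact h _ hadm n x
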